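/- Let $d,l\ge 2$ be fixed integers. For $m\ge 1$ with $d\mid lm$, a $(d,l)$-regular hypergraph with hyperedge set $\{1,\dots,m\}$ is a division of $lm$ labelled half-edges, $l$ of them belonging to each hyperedge, into disjoint sets of size $d$, called the vertices; let $\mathcal G_{m,d,l}$ be uniformly distributed on the set of all of them. A set $M$ of hyperedges is a matching if no two distinct half-edges belonging to hyperedges of $M$ (to the same one or to different ones) share a vertex. A $k$-cycle ($k\ge1$) is an alternating sequence $v_0,e_1,v_1,\dots,e_k,v_k=v_0$ in which $v_1,\dots,v_k$ are distinct vertices, $e_1,\dots,e_k$ are distinct hyperedges, and each $e_i$ has two different half-edges of which one is incident to $v_{i-1}$ and the other to $v_i$; sequences that differ only in the starting point or in the direction are the same cycle. (So a $1$-cycle is given by a hyperedge that has at least two half-edges at one and the same vertex.) Let $C_k$ be the number of $k$-cycles of $\mathcal G_{m,d,l}$, let $b\in\mathbb N$ be fixed, and let $m\to\infty$ along integers with $d\mid lm$. 1. $(C_1,\dots,C_b)$ converges in distribution to a vector of independent Poisson random variables with means $\lambda_k=\frac{((d-1)(l-1))^k}{2k}$, and $\mathbb E(C_k)\to\lambda_k$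 for $1\le k\le b$. 2. Let $\beta\in(0,\frac1d)$, and for each $m$ let $M_0$ be a fixed set of hyperedges with $|M_0|/m\to\beta$ (for instance $|M_0|=m\beta$ when $m\beta$ is an integer). Conditional on $M_0$ being a matching of $\mathcal G_{m,d,l}$, $(C_1,\dots,C_b)$ converges in distribution to a vector of independent Poisson random variables with means $\mu_{\beta,k}=\frac{((d-1)(l-1))^k}{2k}\left(1+\left(\frac{-\beta}{1-\beta}\right)^k\right)$, and the conditional expectation of $C_k$ given that $M_0$ is a matching converges to $\mu_{\beta,k}$ for $1\le k\le b$. -/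

import Mathlib

open Filter Topology MeasureTheory ProbabilityTheory

/-- The labelled half-edges of a hypergraph with `m` hyperedges of size `l`: the pair `(e, a)` is
the `a`-th half-edge of the hyperedge `e`. -/
abbrev HalfEdge (l m : ℕ) : Type := Fin m × Fin l

/-- A `(d, l)`-regular hypergraph with hyperedge set `Fin m`: a division of the `l * m` labelled
half-edges into disjoint sets of size `d`. The parts of the division are the vertices. -/
structure RegHypergraph (d l m : ℕ) where
  division : Finpartition (Finset.univ : Finset (HalfEdge l m))
  card_eq : ∀ v ∈ division.parts, v.card = d

namespace RegHypergraph

variable {d l m : ℕ}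

theorem division_injective :
    Function.Injective (division : RegHypergraph d l m → _) := by
  rintro ⟨P, hP⟩ ⟨Q, hQ⟩ h
  cases h
  rfl

instance : Finite (RegHypergraph d l m) := Finite.of_injective _ division_injective

/-- Every set of hypergraphs is an event. -/
instance : MeasurableSpace (RegHypergraph d l m) := ⊤

/-- The set of vertices; a vertex is the set of the half-edges incident to it. -/
def vertices (G : RegHypergraph d l m) : Finset (Finset (HalfEdge l m)) := G.division.parts

/-- `M` is a matching: no two distinct half-edges belonging to hyperedges of `M`
(to the same hyperedge or to different ones) share a vertex. -/
def IsMatching (G : RegHypergraph d l m) (M : Finset (Fin m)) : Prop :=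
  ∀ v ∈ G.vertices, ∀ x ∈ v, ∀ y ∈ v, x.1 ∈ M → y.1 ∈ M → x = y

/-- A closed alternating sequence `v 0, e 0, v 1, e 1, …, v (k-1), e (k-1), v 0` of distinct
vertices and distinct hyperedges, in which `e i` has two different half-edges, one at `v i` and the
other at `v (i + 1)` (for `k = 1`: two different half-edges at `v 0`; for `k ≥ 2` the half-edges
are different as soon as the vertices are). -/
structure CycleSeq (G : RegHypergraph d l m) (k : ℕ) where
  v : ZMod k → Finset (HalfEdge l m)
  e : ZMod k → Fin m
  v_mem : ∀ i, v i ∈ G.vertices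
  v_injective : Function.Injective v
  e_injective : Function.Injective e
  incident : ∀ i, ∃ x ∈ v i, ∃ y ∈ v (i + 1), x ≠ y ∧ x.1 = e i ∧ y.1 = e i

/-- `c'` arises from `c` by moving the starting point one step, or by reversing the direction. -/
def CycleSeq.Step {G : RegHypergraph d l m} {k : ℕ} (c c' : G.CycleSeq k) : Prop :=
  (∀ i, c'.v i = c.v (i + 1) ∧ c'.e i = c.e (i + 1)) ∨
    (∀ i, c'.v i = c.v (-i) ∧ c'.e i = c.e (-i - 1))

/-- A `k`-cycle: a closed alternating sequence up to the choice of the starting point and of the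
direction (`Quot` identifies along the equivalence relation generated by `CycleSeq.Step`). -/
def Cycle (G : RegHypergraph d l m) (k : ℕ) : Type :=
  Quot (CycleSeq.Step (G := G) (k := k))

/-- The number `C_k` of `k`-cycles of `G`. -/
noncomputable def cycleCount (G : RegHypergraph d l m) (k : ℕ) : ℕ := Nat.card (G.Cycle k)

end RegHypergraph

/-- The law of the random `(d, l)`-regular hypergraph with `m` hyperedges: the uniform
distribution on all of them. -/
noncomputable def randomRegHypergraph (d l m : ℕ) : Measure (RegHypergraph d l m) :=
  uniformOn Set.univ

/-- `((d - 1) (l - 1)) ^ k / (2 k)`. -/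
noncomputable def cycleMean (d l k : ℕ) : ℝ :=
  (((d : ℝ) - 1) * ((l : ℝ) - 1)) ^ k / (2 * (k : ℝ))

/-- `((d - 1) (l - 1)) ^ k / (2 k) * (1 + (-β / (1 - β)) ^ k)`. -/
noncomputable def cycleMeanMatching (d l : ℕ) (β : ℝ) (k : ℕ) : ℝ :=
  cycleMean d l k * (1 + (-β / (1 - β)) ^ k)

/-- Under the laws `P j` of hypergraphs with `m j` hyperedges, the cycle counts `C_1, …, C_b`
converge jointly in distribution, as `j → ∞`, to independent Poisson variables with means
`mean 1, …, mean b` (the joint probability functions on `ℕ ^ b` converge pointwise to the product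
of the Poisson ones), and their expectations converge to these means. -/
def CycleCountsTendToPoisson {d l : ℕ} {m : ℕ → ℕ} (P : ∀ j, Measure (RegHypergraph d l (m j)))
    (b : ℕ) (mean : ℕ → ℝ) : Prop :=
  (∀ c : Fin b → ℕ,
    Tendsto (fun j => (P j).real {G | ∀ k : Fin b, G.cycleCount (k + 1) = c k}) atTop
      (𝓝 (∏ k : Fin b,
        Real.exp (-mean (k + 1)) * mean (k + 1) ^ c k / (Nat.factorial (c k) : ℝ)))) ∧
  (∀ k : Fin b,
    Tendsto (fun j => ∫ G, (G.cycleCount (k + 1) : ℝ) ∂(P j)) atTop (𝓝 (mean (k + 1))))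

/-! The proof is the method of moments. Colour a half-edge `true` if its hyperedge lies in the
prescribed matching `M` and `false` otherwise; the unconditional statement is the case `M = ∅`, `β =
0`. In place of cycles one counts circuits, which are cycles with a root, a direction and chosen
half-edges. A circuit is indexed by a set `I` with a successor permutation `s`. Disjoint families of
circuits are again circuits, on a disjoint union of rotations, so a single first-moment estimate
yields all joint factorial moments.

The estimate (`tendsto_avg_card_circuits`) exchanges randomness. The hypergraphs in which `M` is a
matching are permuted by the colour-preserving permutations of the half-edges. Hence the probability
that a tuple of distinct half-edges shows a given pattern of vertex incidences depends only on its
colours, and it may be averaged over all distinct tuples with these colours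
(`sum_card_filter_mul_card`). In that average the vertex pairs of given colours have the same number
in every admissible hypergraph (`IsMatching.card_vertPairs`). No estimate of the number of
hypergraphs is needed. A colouring `τ` of `I` contributes `((d-1)(l-1))^|I|` times a product of
`transition` entries. Summing over `τ` on a `k`-cycle gives the trace of the `k`-th power of a 2×2
matrix with eigenvalues `1` and `-β/(1-β)`.

A cycle corresponds to exactly `2k` circuits, and distinct cycles are disjoint, unless some
hyperedge or vertex carries three half-edges of two short circuits. Such crowded walks use more
half-edges than hyperedges and vertices together (`IsWalk.card_lt`), so their expected number tends
to `0` (`tendsto_avg_crowdedWalks`). This also bounds the number of circuits summed over the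
hypergraphs that are not good. Truncated inclusion-exclusion then turns the moments into
probabilities (`tendsto_avg_indicator_of_factorialMoments`). -/

/-! ### Counting tuples with and without coincidences. -/

-- The values at class representatives are free, and each coordinate then has at most `K` choices.
-- Only the exponent, the number of classes, matters later.
open scoped Classical in
theorem card_filter_map_eq_le {W α β : Type*} [Fintype W] [Fintype α] [DecidableEq β] (r : Setoid W) (g : α → β)
    (K : ℕ) (hK : ∀ a, (Finset.univ.filter fun x => g x = g a).card ≤ K) :
    (Finset.univ.filter fun f : W → α => ∀ i j, r i j → g (f i) = g (f j)).card ≤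
      K ^ Fintype.card W * Fintype.card α ^ Fintype.card (Quotient r) := by
  have h := Finset.card_le_mul_card_image
    (s := Finset.univ.filter fun f : W → α => ∀ i j, r i j → g (f i) = g (f j))
    (f := fun f (c : Quotient r) => f c.out) (K ^ Fintype.card W) ?_
  · refine h.trans (Nat.mul_le_mul_left _ ?_)
    refine (Finset.card_le_univ _).trans ?_
    simp
  · intro u _
    calc _ ≤ (Fintype.piFinset fun i : W =>
          Finset.univ.filter fun x => g x = g (u (Quotient.mk r i))).card := by
          refine Finset.card_le_card fun f hf => ?_
          simp only [Finset.mem_filter, Finset.mem_univ, true_and, Fintype.mem_piFinset] at hf ⊢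
          intro i
          rw [← hf.2]
          exact hf.1 _ _ (r.symm (Quotient.mk_out i))
      _ ≤ _ := by
          rw [Fintype.card_piFinset]
          refine (Finset.prod_le_prod' fun i _ => hK _).trans ?_
          simp

-- Forget coordinate `j`: it lies in the fibre of `g` selected by coordinate `i`, so at most `K`
-- values are lost.
open scoped Classical in
theorem card_piFinset_collision_le {I α β : Type*} [Fintype I] [DecidableEq β] (S : I → Finset α)
    (g : α → β) (K N : ℕ) (hK : ∀ i b, ((S i).filter fun x => g x = b).card ≤ K)
    (hS : ∀ i, (S i).card ≤ N) {i j : I} (hij : i ≠ j) :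
    ((Fintype.piFinset S).filter fun f => g (f i) = g (f j)).card ≤
      K * N ^ (Fintype.card I - 1) := by
  have h := Finset.card_le_mul_card_image
    (s := (Fintype.piFinset S).filter fun f => g (f i) = g (f j))
    (f := fun f (a : {a : I // a ≠ j}) => f a) K ?_
  · refine h.trans (Nat.mul_le_mul_left _ ?_)
    calc _ ≤ (Fintype.piFinset fun a : {a : I // a ≠ j} => S a).card := by
          refine Finset.card_le_card fun u hu => ?_
          obtain ⟨f, hf, rfl⟩ := Finset.mem_image.1 hu
          simp only [Finset.mem_filter, Fintype.mem_piFinset] at hf ⊢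
          exact fun a => hf.1 a
      _ ≤ _ := by
          rw [Fintype.card_piFinset]
          refine (Finset.prod_le_prod' fun i _ => hS _).trans ?_
          simp [Fintype.card_subtype_compl]
  · intro u _
    refine (Finset.card_le_card_of_injOn (fun f => f j) (t := (S j).filter fun x =>
      g x = g (u ⟨i, hij⟩)) ?_ ?_).trans (hK _ _)
    · intro f hf
      simp only [Finset.coe_filter, Finset.mem_filter, Set.mem_ofPred_eq,
        Fintype.mem_piFinset] at hf ⊢
      rw [← hf.2, hf.1.2]
      exact ⟨hf.1.1 j, rfl⟩
    · intro f hf f' hf' hff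
      simp only [Finset.coe_filter, Finset.mem_filter, Set.mem_ofPred_eq] at hf hf'
      funext a
      by_cases ha : a = j
      · exact ha ▸ hff
      · exact congrFun (hf.2.trans hf'.2.symm) ⟨a, ha⟩

-- A union bound over pairs of coordinates. The error is one order lower in `N`, so distinctness is
-- asymptotically free.
open scoped Classical in
theorem prod_card_le_card_injective_add {I α β : Type*} [Fintype I] [DecidableEq β]
    (S : I → Finset α) (g : α → β) (K N : ℕ)
    (hK : ∀ i b, ((S i).filter fun x => g x = b).card ≤ K) (hS : ∀ i, (S i).card ≤ N) :
    ∏ i, (S i).card ≤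
      ((Fintype.piFinset S).filter fun f => Function.Injective fun i => g (f i)).card +
        Fintype.card I ^ 2 * (K * N ^ (Fintype.card I - 1)) := by
  rw [← Fintype.card_piFinset,
    ← Finset.card_filter_add_card_filter_not (p := fun f => Function.Injective fun i => g (f i))]
  refine Nat.add_le_add_left ?_ _
  calc _ ≤ ((Finset.univ.filter fun p : I × I => p.1 ≠ p.2).biUnion fun p =>
        (Fintype.piFinset S).filter fun f => g (f p.1) = g (f p.2)).card := by
        refine Finset.card_le_card fun f hf => ?_
        simp only [Finset.mem_filter, Function.Injective, not_forall] at hf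
        obtain ⟨hf, i, j, h, hij⟩ := hf
        simp only [Finset.mem_biUnion, Finset.mem_filter, Finset.mem_univ, true_and]
        exact ⟨(i, j), hij, hf, h⟩
    _ ≤ _ := by
        refine Finset.card_biUnion_le.trans ?_
        refine (Finset.sum_le_card_nsmul _ _ (K * N ^ (Fintype.card I - 1)) ?_).trans ?_
        · intro p hp
          exact card_piFinset_collision_le S g K N hK hS (Finset.mem_filter.1 hp).2
        · rw [smul_eq_mul]
          refine Nat.mul_le_mul_right _ ((Finset.card_le_univ _).trans ?_)
          simp [sq]

/-- Two tuples with the same coincidences and the same colours are related by a permutation that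
preserves the colours. -/
theorem exists_perm_comp_eq {W α κ : Type*} [Finite W] (c : α → κ) (z w : W → α)
    (hk : ∀ i j, z i = z j ↔ w i = w j) (hc : ∀ i, c (z i) = c (w i)) :
    ∃ σ : Equiv.Perm α, (∀ a, c (σ a) = c a) ∧ ∀ i, σ (z i) = w i := by
  classical
  have := Fintype.ofFinite W
  suffices h : ∀ s : Finset W, ∃ σ : Equiv.Perm α, (∀ a, c (σ a) = c a) ∧ ∀ i ∈ s, σ (z i) = w i by
    obtain ⟨σ, h₁, h₂⟩ := h Finset.univ
    exact ⟨σ, h₁, fun i => h₂ i (Finset.mem_univ _)⟩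
  intro s
  induction s using Finset.induction_on with
  | empty => exact ⟨1, by simp, by simp⟩
  | insert i s hi ih =>
    obtain ⟨σ, h₁, h₂⟩ := ih
    have hcol : c (σ (z i)) = c (w i) := (h₁ _).trans (hc i)
    -- The swapped points have the same colour, and neither is an earlier `w j` unless `z j = z i`.
    refine ⟨Equiv.swap (σ (z i)) (w i) * σ, fun a => ?_, fun j hj => ?_⟩
    · rw [Equiv.Perm.mul_apply, Equiv.swap_apply_def]
      split_ifs with h h'
      · rw [← hcol, ← h, h₁]
      · rw [hcol, ← h', h₁]
      · exact h₁ a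
    · rw [Equiv.Perm.mul_apply]
      rcases Finset.mem_insert.1 hj with rfl | hj
      · simp
      · by_cases hz : z j = z i
        · rw [hz, Equiv.swap_apply_left, (hk j i).1 hz]
        · rw [Equiv.swap_apply_of_ne_of_ne, h₂ j hj]
          · exact fun h => hz (σ.injective h)
          · rw [h₂ j hj]; exact fun h => hz ((hk j i).2 h)

/-! ### The incidence relation, relabelling of half-edges and the exchange identity. -/

namespace RegHypergraph

variable {d l m : ℕ}

/-- The vertex incident to the half-edge `h`. -/
def vert (G : RegHypergraph d l m) (h : HalfEdge l m) : Finset (HalfEdge l m) :=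
  G.division.part h

theorem mem_vert (G : RegHypergraph d l m) (h : HalfEdge l m) : h ∈ G.vert h :=
  G.division.mem_part (Finset.mem_univ h)

theorem vert_mem (G : RegHypergraph d l m) (h : HalfEdge l m) : G.vert h ∈ G.vertices :=
  G.division.part_mem.2 (Finset.mem_univ h)

theorem vert_eq_of_mem (G : RegHypergraph d l m) {v : Finset (HalfEdge l m)} {h : HalfEdge l m}
    (hv : v ∈ G.vertices) (hh : h ∈ v) : G.vert h = v :=
  G.division.part_eq_of_mem hv hh

theorem mem_vert_iff (G : RegHypergraph d l m) {x y : HalfEdge l m} :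
    x ∈ G.vert y ↔ G.vert x = G.vert y :=
  G.division.mem_part_iff_part_eq_part (Finset.mem_univ _) (Finset.mem_univ _)

theorem card_vert (G : RegHypergraph d l m) (h : HalfEdge l m) : (G.vert h).card = d :=
  G.card_eq _ (G.vert_mem h)

theorem filter_vert_eq (G : RegHypergraph d l m) (h : HalfEdge l m) :
    (Finset.univ.filter fun x => G.vert x = G.vert h) = G.vert h := by
  ext x; simp [mem_vert_iff]

theorem vertices_eq_image (G : RegHypergraph d l m) : G.vertices = Finset.univ.image G.vert := by
  ext v
  simp only [Finset.mem_image, Finset.mem_univ, true_and]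
  constructor
  · intro hv
    obtain ⟨h, hh⟩ := G.division.nonempty_of_mem_parts hv
    exact ⟨h, G.vert_eq_of_mem hv hh⟩
  · rintro ⟨h, rfl⟩; exact G.vert_mem h

theorem ext_vert {G G' : RegHypergraph d l m}
    (h : ∀ x y, G.vert x = G.vert y ↔ G'.vert x = G'.vert y) : G = G' := by
  apply division_injective
  apply Finpartition.ext
  have : G.vert = G'.vert := by
    funext x
    ext y
    rw [mem_vert_iff, mem_vert_iff, h]
  change G.vertices = G'.vertices
  rw [vertices_eq_image, vertices_eq_image, this]

theorem isMatching_iff (G : RegHypergraph d l m) (M : Finset (Fin m)) :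
    G.IsMatching M ↔ ∀ x y, G.vert x = G.vert y → x.1 ∈ M → y.1 ∈ M → x = y := by
  constructor
  · intro h x y hxy hx hy
    exact h _ (G.vert_mem y) x (G.mem_vert_iff.2 hxy) y (G.mem_vert y) hx hy
  · intro h v hv x hx y hy
    exact h x y ((G.vert_eq_of_mem hv hx).trans (G.vert_eq_of_mem hv hy).symm)

open scoped Classical in
/-- The hypergraph whose vertices are the fibres of `f`. -/
noncomputable def ofMap {β : Type*} (f : HalfEdge l m → β)
    (hf : ∀ h, (Finset.univ.filter fun x => f x = f h).card = d) : RegHypergraph d l m where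
  division := Finpartition.ofSetoid (Setoid.ker f)
  card_eq v hv := by
    obtain ⟨h, hh⟩ := (Finpartition.ofSetoid (Setoid.ker f)).nonempty_of_mem_parts hv
    rw [← (Finpartition.ofSetoid (Setoid.ker f)).part_eq_of_mem hv hh, ← hf h]
    congr 1
    ext x
    rw [Finpartition.mem_part_ofSetoid_iff_rel]
    simp [Setoid.ker_def, eq_comm]

open scoped Classical in
theorem vert_ofMap {β : Type*} (f : HalfEdge l m → β)
    (hf : ∀ h, (Finset.univ.filter fun x => f x = f h).card = d) (x y : HalfEdge l m) :
    (ofMap f hf).vert x = (ofMap f hf).vert y ↔ f x = f y := by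
  rw [← mem_vert_iff]
  unfold vert ofMap
  rw [Finpartition.mem_part_ofSetoid_iff_rel]
  simp [Setoid.ker_def, eq_comm]

/-- Relabelling of the half-edges. -/
noncomputable def relabel (σ : Equiv.Perm (HalfEdge l m)) (G : RegHypergraph d l m) :
    RegHypergraph d l m :=
  ofMap (fun h => G.vert (σ.symm h)) (by
    intro h
    refine Eq.trans ?_ ((congrArg _ (G.filter_vert_eq (σ.symm h))).trans (G.card_vert _))
    exact Finset.card_bij' (fun x _ => σ.symm x) (fun x _ => σ x) (by simp) (by simp) (by simp)
      (by simp))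

theorem vert_relabel (σ : Equiv.Perm (HalfEdge l m)) (G : RegHypergraph d l m)
    (x y : HalfEdge l m) : (relabel σ G).vert x = (relabel σ G).vert y ↔
      G.vert (σ.symm x) = G.vert (σ.symm y) :=
  vert_ofMap _ _ _ _

theorem relabel_symm_relabel (σ : Equiv.Perm (HalfEdge l m)) (G : RegHypergraph d l m) :
    relabel σ.symm (relabel σ G) = G :=
  ext_vert fun x y => by simp [vert_relabel]

theorem relabel_relabel_symm (σ : Equiv.Perm (HalfEdge l m)) (G : RegHypergraph d l m) :
    relabel σ (relabel σ.symm G) = G :=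
  ext_vert fun x y => by simp [vert_relabel]

/-- Whether the half-edge `h` belongs to a hyperedge of `M`. -/
def col (M : Finset (Fin m)) (h : HalfEdge l m) : Bool := decide (h.1 ∈ M)

theorem IsMatching.relabel {M : Finset (Fin m)} {G : RegHypergraph d l m} (hG : G.IsMatching M)
    {σ : Equiv.Perm (HalfEdge l m)} (hσ : ∀ h, col M (σ h) = col M h) :
    (relabel σ G).IsMatching M := by
  rw [isMatching_iff] at hG ⊢
  intro x y hxy hx hy
  have key : ∀ h : HalfEdge l m, h.1 ∈ M → (σ.symm h).1 ∈ M := by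
    intro h hh
    have := hσ (σ.symm h)
    simp only [Equiv.apply_symm_apply, col, decide_eq_decide] at this
    exact this.1 hh
  exact σ.symm.injective (hG _ _ ((vert_relabel _ _ _ _).1 hxy) (key x hx) (key y hy))

/-- The hypergraphs in which `M` is a matching. -/
noncomputable def matchingSet (d l : ℕ) {m : ℕ} (M : Finset (Fin m)) :
    Finset (RegHypergraph d l m) :=
  (Set.toFinite {G : RegHypergraph d l m | G.IsMatching M}).toFinset

theorem mem_matchingSet {M : Finset (Fin m)} {G : RegHypergraph d l m} :
    G ∈ matchingSet d l M ↔ G.IsMatching M := by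
  simp [matchingSet]

open scoped Classical in
/-- The number of hypergraphs with a given pattern of incidences of a tuple of half-edges depends
only on the coincidences and on the colours in the tuple. -/
theorem card_filter_matchingSet_eq {W : Type*} [Finite W] (M : Finset (Fin m))
    (Q : (W → W → Prop) → Prop) (z w : W → HalfEdge l m)
    (hk : ∀ i j, z i = z j ↔ w i = w j) (hc : ∀ i, col M (z i) = col M (w i)) :
    ((matchingSet d l M).filter fun G => Q fun i j => G.vert (z i) = G.vert (z j)).card =
      ((matchingSet d l M).filter fun G => Q fun i j => G.vert (w i) = G.vert (w j)).card := by
  obtain ⟨σ, h₁, h₂⟩ := exists_perm_comp_eq (col M) z w hk hc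
  have h₁' : ∀ h, col M (σ.symm h) = col M h := fun h => by
    rw [← h₁ (σ.symm h), Equiv.apply_symm_apply]
  refine Finset.card_bij' (fun G _ => relabel σ G) (fun G _ => relabel σ.symm G) ?_ ?_ ?_ ?_
  · intro G hG
    simp only [Finset.mem_filter, mem_matchingSet, vert_relabel] at hG ⊢
    refine ⟨hG.1.relabel h₁, ?_⟩
    simpa [← h₂] using hG.2
  · intro G hG
    simp only [Finset.mem_filter, mem_matchingSet, vert_relabel] at hG ⊢
    refine ⟨hG.1.relabel h₁', ?_⟩
    simpa [h₂] using hG.2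
  · intro G _; exact relabel_symm_relabel σ G
  · intro G _; exact relabel_relabel_symm σ G

open scoped Classical in
/-- Exchange of the randomness of the vertices for the one of the labels of the half-edges. -/
theorem sum_card_filter_mul_card {W : Type*} [Finite W] (M : Finset (Fin m))
    (Q : (W → W → Prop) → Prop) (A B : Finset (W → HalfEdge l m))
    (hk : ∀ z ∈ A, ∀ w ∈ B, ∀ i j, z i = z j ↔ w i = w j)
    (hc : ∀ z ∈ A, ∀ w ∈ B, ∀ i, col M (z i) = col M (w i)) :
    (∑ G ∈ matchingSet d l M, (A.filter fun z => Q fun i j => G.vert (z i) = G.vert (z j)).card) *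
        B.card =
      A.card * ∑ G ∈ matchingSet d l M,
        (B.filter fun z => Q fun i j => G.vert (z i) = G.vert (z j)).card := by
  -- Summing over tuples first makes all summands equal, for `A` and `B` alike, by the symmetry
  -- under relabelling.
  have key : ∀ C : Finset (W → HalfEdge l m), (∑ G ∈ matchingSet d l M,
      (C.filter fun z => Q fun i j => G.vert (z i) = G.vert (z j)).card) = ∑ z ∈ C,
      ((matchingSet d l M).filter fun G => Q fun i j => G.vert (z i) = G.vert (z j)).card := by
    intro C
    simp only [Finset.card_filter]
    exact Finset.sum_comm
  rw [key, key, Finset.sum_mul, Finset.card_eq_sum_ones A, Finset.sum_mul]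
  refine Finset.sum_congr rfl fun z hz => ?_
  rw [one_mul, mul_comm, ← smul_eq_mul, ← Finset.sum_const]
  exact Finset.sum_congr rfl fun w hw =>
    card_filter_matchingSet_eq M Q z w (hk z hz w hw) (hc z hz w hw)

end RegHypergraph

/-! ### Averages, and from factorial moments to the Poisson law. -/

/-- The average of `f` over the finite set `S`. -/
noncomputable def avg {Ω : Type*} (S : Finset Ω) (f : Ω → ℝ) : ℝ := (∑ ω ∈ S, f ω) / (S.card : ℝ)

section avg

variable {Ω : Type*} (S : Finset Ω)

theorem avg_congr {f g : Ω → ℝ} (h : ∀ ω ∈ S, f ω = g ω) : avg S f = avg S g := by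
  unfold avg; rw [Finset.sum_congr rfl h]

theorem avg_add (f g : Ω → ℝ) : avg S (fun ω => f ω + g ω) = avg S f + avg S g := by
  unfold avg; rw [Finset.sum_add_distrib, add_div]

theorem avg_sub (f g : Ω → ℝ) : avg S (fun ω => f ω - g ω) = avg S f - avg S g := by
  unfold avg; rw [Finset.sum_sub_distrib, sub_div]

theorem avg_const_mul (a : ℝ) (f : Ω → ℝ) : avg S (fun ω => a * f ω) = a * avg S f := by
  unfold avg; rw [← Finset.mul_sum, mul_div_assoc]

theorem avg_sum {ι : Type*} (s : Finset ι) (f : ι → Ω → ℝ) :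
    avg S (fun ω => ∑ i ∈ s, f i ω) = ∑ i ∈ s, avg S (f i) := by
  unfold avg; rw [Finset.sum_comm, Finset.sum_div]

theorem avg_mono {f g : Ω → ℝ} (h : ∀ ω ∈ S, f ω ≤ g ω) : avg S f ≤ avg S g := by
  unfold avg; gcongr with ω hω; exact h ω hω

theorem avg_nonneg {f : Ω → ℝ} (h : ∀ ω ∈ S, 0 ≤ f ω) : 0 ≤ avg S f :=
  div_nonneg (Finset.sum_nonneg h) (Nat.cast_nonneg _)

theorem abs_avg_le (f : Ω → ℝ) : |avg S f| ≤ avg S fun ω => |f ω| := by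
  unfold avg; rw [abs_div, Nat.abs_cast]; gcongr; exact Finset.abs_sum_le_sum_abs _ _

end avg

/-- A truncation of the inclusion-exclusion formula for the indicator function of `c`. -/
noncomputable def truncatedIndicator (c R x : ℕ) : ℝ :=
  ∑ r ∈ Finset.range R, (-1) ^ r * ((c + r).choose c : ℝ) * (x.choose (c + r) : ℝ)

/-- The truncated inclusion-exclusion sum without signs. -/
noncomputable def truncatedBound (c R x : ℕ) : ℝ :=
  ∑ r ∈ Finset.range R, ((c + r).choose c : ℝ) * (x.choose (c + r) : ℝ)

theorem abs_truncatedIndicator_le (c R x : ℕ) :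
    |truncatedIndicator c R x| ≤ truncatedBound c R x := by
  refine (Finset.abs_sum_le_sum_abs _ _).trans (Finset.sum_le_sum fun r _ => ?_)
  simp [abs_mul]

/-- A Bonferroni inequality. With `x = c + n` the sum is `(c+n).choose c` times an alternating
partial row sum of binomials, which for `n, R > 0` equals `(n-1).choose (R-1)` up to sign. So the
error is at most the first omitted term. -/
theorem abs_indicator_sub_truncatedIndicator_le (c R x : ℕ) :
    |(if x = c then 1 else 0) - truncatedIndicator c R x| ≤
      ((c + R).choose c : ℝ) * (x.choose (c + R) : ℝ) := by
  rcases lt_or_ge x c with hx | hx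
  · rw [if_neg hx.ne, truncatedIndicator, Finset.sum_eq_zero]
    · simp; positivity
    · intro r _; rw [Nat.choose_eq_zero_of_lt (by omega : x < c + r)]; simp
  obtain ⟨n, rfl⟩ := Nat.exists_eq_add_of_le hx
  have key : ∀ r, ((c + r).choose c : ℝ) * ((c + n).choose (c + r) : ℝ) =
      ((c + n).choose c : ℝ) * (n.choose r : ℝ) := by
    intro r
    rcases le_or_gt r n with hr | hr
    · have := Nat.choose_mul (n := c + n) (k := c + r) (s := c) (by omega)
      rw [Nat.add_sub_cancel_left, Nat.add_sub_cancel_left] at this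
      rw [mul_comm]; exact_mod_cast this
    · rw [Nat.choose_eq_zero_of_lt hr, Nat.choose_eq_zero_of_lt (by omega : c + n < c + r)]; simp
  have hT : truncatedIndicator c R (c + n) =
      ((c + n).choose c : ℝ) * ∑ r ∈ Finset.range R, (-1) ^ r * (n.choose r : ℝ) := by
    rw [truncatedIndicator, Finset.mul_sum]
    refine Finset.sum_congr rfl fun r _ => ?_
    rw [mul_assoc, key]; ring
  rw [key, hT]
  rcases Nat.eq_zero_or_pos n with rfl | hn
  · rcases Nat.eq_zero_or_pos R with rfl | hR
    · simp
    · obtain ⟨R, rfl⟩ := Nat.exists_eq_add_of_le' hR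
      rw [Finset.sum_range_succ']
      simp
  · rw [if_neg (by omega), zero_sub, abs_neg, abs_mul, Nat.abs_cast]
    gcongr
    rcases Nat.eq_zero_or_pos R with rfl | hR
    · simp
    · obtain ⟨R, rfl⟩ := Nat.exists_eq_add_of_le' hR
      obtain ⟨n, rfl⟩ := Nat.exists_eq_add_of_le' hn
      have := Int.alternating_sum_range_choose_eq_choose (n := n) (m := R)
      have h : (∑ r ∈ Finset.range (R + 1), (-1 : ℝ) ^ r * ((n + 1).choose r : ℝ)) =
          (-1) ^ R * (n.choose R : ℝ) := by exact_mod_cast this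
      rw [h]
      simp only [abs_mul, abs_pow, abs_neg, abs_one, one_pow, one_mul, Nat.abs_cast]
      rw [Nat.choose_succ_succ]
      exact_mod_cast Nat.le_add_right _ _

/-- Telescoping over the factors. The bound is kept as a difference of products so that, for
truncated sums, it compares consecutive unsigned truncations, whose averages have known limits. -/
theorem abs_prod_sub_prod_le {ι : Type*} (s : Finset ι) (a t u e : ι → ℝ)
    (hu : ∀ i ∈ s, |t i| ≤ u i) (he : ∀ i ∈ s, |a i - t i| ≤ e i) :
    |∏ i ∈ s, a i - ∏ i ∈ s, t i| ≤ ∏ i ∈ s, (u i + e i) - ∏ i ∈ s, u i := by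
  classical
  induction s using Finset.induction_on with
  | empty => simp
  | insert i s hi ih =>
    rw [Finset.prod_insert hi, Finset.prod_insert hi, Finset.prod_insert hi, Finset.prod_insert hi]
    have ih := ih (fun j hj => hu j (Finset.mem_insert_of_mem hj))
      (fun j hj => he j (Finset.mem_insert_of_mem hj))
    have h₁ := hu i (Finset.mem_insert_self _ _)
    have h₂ := he i (Finset.mem_insert_self _ _)
    have ha : |∏ j ∈ s, a j| ≤ ∏ j ∈ s, (u j + e j) := by
      rw [Finset.abs_prod]
      refine Finset.prod_le_prod (fun _ _ => abs_nonneg _) fun j hj => ?_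
      have h₃ := hu j (Finset.mem_insert_of_mem hj)
      have h₄ := he j (Finset.mem_insert_of_mem hj)
      calc |a j| = |t j + (a j - t j)| := by ring_nf
        _ ≤ _ := (abs_add_le _ _).trans (add_le_add h₃ h₄)
    calc _ = |(a i - t i) * ∏ j ∈ s, a j + t i * (∏ j ∈ s, a j - ∏ j ∈ s, t j)| := by ring_nf
      _ ≤ |a i - t i| * |∏ j ∈ s, a j| + |t i| * |∏ j ∈ s, a j - ∏ j ∈ s, t j| := by
          refine (abs_add_le _ _).trans ?_; rw [abs_mul, abs_mul]
      _ ≤ e i * ∏ j ∈ s, (u j + e j) + u i * (∏ j ∈ s, (u j + e j) - ∏ j ∈ s, u j) := by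
          gcongr
          · exact (abs_nonneg _).trans h₂
          · exact (abs_nonneg _).trans h₁
      _ = _ := by ring

/-- Expanding the product leaves a finite linear combination of joint factorial moments. Free
coefficients `α` cover the signed and the unsigned truncations at once. -/
theorem tendsto_avg_prod_sum_choose {b : ℕ} {Ω : ℕ → Type*} (S : ∀ j, Finset (Ω j))
    (X : ∀ j, Ω j → Fin b → ℕ) (μ : Fin b → ℝ)
    (h : ∀ r : Fin b → ℕ, Tendsto (fun j => avg (S j) fun ω =>
      ∏ k, ((X j ω k).descFactorial (r k) : ℝ)) atTop (𝓝 (∏ k, μ k ^ r k)))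
    (s : Finset ℕ) (n : Fin b → ℕ → ℕ) (α : Fin b → ℕ → ℝ) :
    Tendsto (fun j => avg (S j) fun ω => ∏ k, ∑ i ∈ s, α k i * ((X j ω k).choose (n k i) : ℝ))
      atTop (𝓝 (∏ k, ∑ i ∈ s, α k i * (μ k ^ n k i / ((n k i).factorial : ℝ)))) := by
  have e : ∀ j, (avg (S j) fun ω => ∏ k, ∑ i ∈ s, α k i * ((X j ω k).choose (n k i) : ℝ)) =
      ∑ p ∈ Fintype.piFinset fun _ => s, (∏ k, (α k (p k) / ((n k (p k)).factorial : ℝ))) *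
        avg (S j) fun ω => ∏ k, ((X j ω k).descFactorial (n k (p k)) : ℝ) := by
    intro j
    simp only [Finset.prod_univ_sum, ← avg_const_mul, ← avg_sum]
    refine avg_congr _ fun ω _ => Finset.sum_congr rfl fun p _ => ?_
    rw [← Finset.prod_mul_distrib]
    refine Finset.prod_congr rfl fun k _ => ?_
    rw [Nat.descFactorial_eq_factorial_mul_choose]
    push_cast
    field_simp
  rw [funext e, Finset.prod_univ_sum]
  refine tendsto_finsetSum _ fun p _ => ?_
  have : (∏ k, α k (p k) * (μ k ^ n k (p k) / ((n k (p k)).factorial : ℝ))) =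
      (∏ k, (α k (p k) / ((n k (p k)).factorial : ℝ))) * ∏ k, μ k ^ n k (p k) := by
    rw [← Finset.prod_mul_distrib]
    exact Finset.prod_congr rfl fun k _ => by ring
  rw [this]
  exact (h _).const_mul _

/-- The binomial turns `1/(c+r)!` into `1/(c! r!)`, leaving an exponential series. The value `g =
-1` gives the Poisson weight, `g = 1` the convergence of the unsigned sums. -/
theorem tendsto_sum_range_pow_mul_choose (c : ℕ) (g μ : ℝ) :
    Tendsto (fun R => ∑ r ∈ Finset.range R,
      g ^ r * ((c + r).choose c : ℝ) * (μ ^ (c + r) / ((c + r).factorial : ℝ))) atTop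
      (𝓝 (Real.exp (g * μ) * μ ^ c / (c.factorial : ℝ))) := by
  have h := (NormedSpace.expSeries_div_hasSum_exp (g * μ)).tendsto_sum_nat.const_mul
    (μ ^ c / (c.factorial : ℝ))
  rw [← Real.exp_eq_exp_ℝ] at h
  convert h using 2 with R
  · rw [Finset.mul_sum]
    refine Finset.sum_congr rfl fun r _ => ?_
    rw [← Nat.add_choose_mul_factorial_mul_factorial c r, Nat.choose_symm_add]
    have : ((c + r).choose r : ℝ) ≠ 0 := by
      exact_mod_cast (Nat.choose_pos (Nat.le_add_left r c)).ne'
    push_cast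
    rw [mul_pow, pow_add]
    field_simp
  · ring

/-- Convergence of the joint factorial moments to those of independent Poisson variables implies
convergence of the joint probability function. -/
theorem tendsto_avg_indicator_of_factorialMoments {b : ℕ} {Ω : ℕ → Type*} (S : ∀ j, Finset (Ω j))
    (X : ∀ j, Ω j → Fin b → ℕ) (μ : Fin b → ℝ)
    (h : ∀ r : Fin b → ℕ, Tendsto (fun j => avg (S j) fun ω =>
      ∏ k, ((X j ω k).descFactorial (r k) : ℝ)) atTop (𝓝 (∏ k, μ k ^ r k))) (c : Fin b → ℕ) :
    Tendsto (fun j => avg (S j) fun ω => ∏ k, if X j ω k = c k then (1 : ℝ) else 0) atTop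
      (𝓝 (∏ k, Real.exp (-μ k) * μ k ^ c k / ((c k).factorial : ℝ))) := by
  have expand : ∀ (g : ℝ) (R : ℕ), Tendsto (fun j => avg (S j) fun ω => ∏ k,
      ∑ r ∈ Finset.range R, g ^ r * ((c k + r).choose (c k) : ℝ) *
        ((X j ω k).choose (c k + r) : ℝ))
      atTop (𝓝 (∏ k, ∑ r ∈ Finset.range R,
        g ^ r * ((c k + r).choose (c k) : ℝ) * (μ k ^ (c k + r) / ((c k + r).factorial : ℝ)))) :=
    fun g R => tendsto_avg_prod_sum_choose S X μ h (Finset.range R) (fun k r => c k + r)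
      (fun k r => g ^ r * ((c k + r).choose (c k) : ℝ))
  have lim : ∀ g : ℝ, Tendsto (fun R => ∏ k, ∑ r ∈ Finset.range R,
      g ^ r * ((c k + r).choose (c k) : ℝ) * (μ k ^ (c k + r) / ((c k + r).factorial : ℝ))) atTop
      (𝓝 (∏ k, Real.exp (g * μ k) * μ k ^ c k / ((c k).factorial : ℝ))) := fun g =>
    tendsto_finsetProd _ fun k _ => tendsto_sum_range_pow_mul_choose (c k) g (μ k)
  have bound : ∀ R j, |(avg (S j) fun ω => ∏ k, if X j ω k = c k then (1 : ℝ) else 0) -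
      avg (S j) fun ω => ∏ k, truncatedIndicator (c k) R (X j ω k)| ≤
      (avg (S j) fun ω => ∏ k, truncatedBound (c k) (R + 1) (X j ω k)) -
        avg (S j) fun ω => ∏ k, truncatedBound (c k) R (X j ω k) := by
    intro R j
    rw [← avg_sub, ← avg_sub]
    refine (abs_avg_le _ _).trans (avg_mono _ fun ω _ => ?_)
    refine (abs_prod_sub_prod_le _ _ _ (fun k => truncatedBound (c k) R (X j ω k))
      (fun k => ((c k + R).choose (c k) : ℝ) * ((X j ω k).choose (c k + R) : ℝ))
      (fun k _ => abs_truncatedIndicator_le _ _ _)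
      fun k _ => abs_indicator_sub_truncatedIndicator_le _ _ _).trans (le_of_eq ?_)
    simp only [truncatedBound, Finset.sum_range_succ]
  rw [Metric.tendsto_atTop]
  intro ε hε
  have hlim := lim (-1)
  simp only [neg_mul, one_mul] at hlim
  have hB := lim 1
  have hB' := ((hB.comp (tendsto_add_atTop_nat 1)).sub hB)
  rw [sub_self] at hB'
  -- Four errors of `ε/4`: two from truncating the limits at `R`, then two from replacing averages
  -- by their limits for this fixed `R`.
  obtain ⟨R, hR₁, hR₂⟩ := ((hlim.eventually (Metric.ball_mem_nhds _ (half_pos (half_pos hε)))).and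
    (hB'.eventually (Metric.ball_mem_nhds _ (half_pos (half_pos hε))))).exists
  have e₁ := (expand (-1) R).eventually (Metric.ball_mem_nhds _ (half_pos (half_pos hε)))
  have e₂ := ((expand 1 (R + 1)).sub (expand 1 R)).eventually
    (Metric.ball_mem_nhds _ (half_pos (half_pos hε)))
  obtain ⟨N, hN⟩ := (e₁.and e₂).exists_forall_of_atTop
  refine ⟨N, fun j hj => ?_⟩
  obtain ⟨h₁, h₂⟩ := hN j hj
  have h₃ := bound R j
  simp only [Real.dist_eq, Function.comp, one_pow, one_mul, sub_zero]
    at h₁ h₂ hR₁ hR₂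
  simp only [truncatedIndicator, truncatedBound] at h₃
  rw [Real.dist_eq]
  rw [abs_lt] at h₁ h₂ hR₁ hR₂ ⊢
  rw [abs_le] at h₃
  constructor <;> linarith [h₁.1, h₁.2, h₂.1, h₂.2, hR₁.1, hR₁.2, hR₂.1, hR₂.2, h₃.1, h₃.2]

/-! ### Coloured pairs of half-edges and existence of matchings. -/

namespace RegHypergraph

variable {d l m : ℕ}

/-- The half-edges of colour `a`. -/
def colorClass (l : ℕ) {m : ℕ} (M : Finset (Fin m)) (a : Bool) : Finset (HalfEdge l m) :=
  Finset.univ.filter fun h => col M h = a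

theorem mem_colorClass {M : Finset (Fin m)} {a : Bool} {h : HalfEdge l m} :
    h ∈ colorClass l M a ↔ col M h = a := by
  simp [colorClass]

theorem card_colorClass_true (M : Finset (Fin m)) : (colorClass l M true).card = M.card * l := by
  have : colorClass l M true = M ×ˢ Finset.univ := by
    ext ⟨e, a⟩; simp [colorClass, col]
  rw [this, Finset.card_product]; simp

theorem card_colorClass_add (M : Finset (Fin m)) :
    (colorClass l M true).card + (colorClass l M false).card = m * l := by
  have := Finset.card_filter_add_card_filter_not (s := (Finset.univ : Finset (HalfEdge l m)))
    (p := fun h => col M h = true)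
  simpa [colorClass] using this

theorem card_colorClass_le (M : Finset (Fin m)) (a : Bool) :
    (colorClass l M a).card ≤ m * l := by
  have := card_colorClass_add (l := l) M
  cases a <;> omega

/-- Ordered pairs of distinct half-edges at the same hyperedge, of colour `a`. -/
def edgePairs (l : ℕ) {m : ℕ} (M : Finset (Fin m)) (a : Bool) :
    Finset (HalfEdge l m × HalfEdge l m) :=
  Finset.univ.filter fun p => p.1.1 = p.2.1 ∧ p.1 ≠ p.2 ∧ col M p.1 = a

/-- Ordered pairs of distinct half-edges at the same vertex, of colours `a` and `b`. -/
def vertPairs (G : RegHypergraph d l m) (M : Finset (Fin m)) (a b : Bool) :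
    Finset (HalfEdge l m × HalfEdge l m) :=
  Finset.univ.filter fun p => G.vert p.1 = G.vert p.2 ∧ p.1 ≠ p.2 ∧ col M p.1 = a ∧ col M p.2 = b

theorem card_filter_pairs {α : Type*} [Fintype α] [DecidableEq α] (P : α → α → Prop)
    [∀ x y, Decidable (P x y)] :
    (Finset.univ.filter fun p : α × α => P p.1 p.2).card =
      ∑ x, (Finset.univ.filter fun y => P x y).card := by
  simp only [Finset.card_filter]
  rw [Fintype.sum_prod_type]

theorem card_filter_edge (e : Fin m) :
    (Finset.univ.filter fun x : HalfEdge l m => x.1 = e).card = l := by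
  have : (Finset.univ.filter fun x : HalfEdge l m => x.1 = e) = {e} ×ˢ Finset.univ := by
    ext ⟨e', a⟩; simp only [Finset.mem_filter, Finset.mem_univ, true_and, Finset.mem_product,
      Finset.mem_singleton, and_true]
  rw [this, Finset.card_product]; simp

theorem card_edgePairs (M : Finset (Fin m)) (a : Bool) :
    (edgePairs l M a).card = (colorClass l M a).card * (l - 1) := by
  rw [edgePairs, card_filter_pairs (fun x y : HalfEdge l m => x.1 = y.1 ∧ x ≠ y ∧ col M x = a),
    colorClass, Finset.card_filter, Finset.sum_mul]
  refine Finset.sum_congr rfl fun x _ => ?_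
  by_cases hx : col M x = a
  · have : (Finset.univ.filter fun y : HalfEdge l m => x.1 = y.1 ∧ x ≠ y ∧ col M x = a) =
        (Finset.univ.filter fun y : HalfEdge l m => y.1 = x.1).erase x := by
      ext y; simp [hx, eq_comm, and_comm]
    rw [this, Finset.card_erase_of_mem (by simp), card_filter_edge, if_pos hx, one_mul]
  · simp [hx]

theorem card_filter_vert_ne (G : RegHypergraph d l m) (x : HalfEdge l m) :
    (Finset.univ.filter fun y => G.vert x = G.vert y ∧ x ≠ y).card = d - 1 := by
  have : (Finset.univ.filter fun y => G.vert x = G.vert y ∧ x ≠ y) = (G.vert x).erase x := by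
    ext y; simp [mem_vert_iff, eq_comm, and_comm]
  rw [this, Finset.card_erase_of_mem (G.mem_vert x), card_vert]

theorem card_vertPairs_add (G : RegHypergraph d l m) (M : Finset (Fin m)) (a : Bool) :
    (G.vertPairs M a true).card + (G.vertPairs M a false).card =
      (colorClass l M a).card * (d - 1) := by
  rw [vertPairs, vertPairs,
    card_filter_pairs (fun x y => G.vert x = G.vert y ∧ x ≠ y ∧ col M x = a ∧ col M y = true),
    card_filter_pairs (fun x y => G.vert x = G.vert y ∧ x ≠ y ∧ col M x = a ∧ col M y = false),
    ← Finset.sum_add_distrib, colorClass, Finset.card_filter, Finset.sum_mul]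
  refine Finset.sum_congr rfl fun x _ => ?_
  by_cases hx : col M x = a
  · rw [if_pos hx, one_mul, ← G.card_filter_vert_ne x]
    refine Eq.trans ?_ (Finset.card_filter_add_card_filter_not (p := fun y => col M y = true))
    rw [Finset.filter_filter, Finset.filter_filter]
    simp [hx, and_assoc]
  · simp [hx]

theorem card_vertPairs_comm (G : RegHypergraph d l m) (M : Finset (Fin m)) (a b : Bool) :
    (G.vertPairs M a b).card = (G.vertPairs M b a).card := by
  refine Finset.card_bij' (fun p _ => p.swap) (fun p _ => p.swap) ?_ ?_ (by simp) (by simp) <;>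
  · intro p hp
    simp only [vertPairs, Finset.mem_filter, Finset.mem_univ, true_and, Prod.fst_swap,
      Prod.snd_swap] at hp ⊢
    exact ⟨hp.1.symm, hp.2.1.symm, hp.2.2.2, hp.2.2.1⟩

theorem IsMatching.card_vertPairs_true_true {G : RegHypergraph d l m} {M : Finset (Fin m)}
    (hG : G.IsMatching M) : (G.vertPairs M true true).card = 0 := by
  rw [isMatching_iff] at hG
  rw [Finset.card_eq_zero, vertPairs, Finset.filter_eq_empty_iff]
  rintro p - ⟨h₁, h₂, h₃, h₄⟩
  simp only [col, decide_eq_true_eq] at h₃ h₄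
  exact h₂ (hG _ _ h₁ h₃ h₄)

/-- The number of ordered pairs of half-edges of colours `a` and `b` at the vertices, divided by
`d - 1`, if the colour `true` is a matching with `x` half-edges and `y` half-edges have the colour
`false`. -/
def pairWeight (x y : ℝ) : Bool → Bool → ℝ
  | true, true => 0
  | true, false => x
  | false, true => x
  | false, false => y - x

/-- Each half-edge has `d - 1` partners at its vertex. The matching forbids pairs `true`-`true`, and
symmetry under swapping then determines the other three counts, independently of `G`. -/
theorem IsMatching.card_vertPairs {G : RegHypergraph d l m} {M : Finset (Fin m)} (hd : 1 ≤ d)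
    (hG : G.IsMatching M) (a b : Bool) :
    ((G.vertPairs M a b).card : ℝ) = pairWeight ((colorClass l M true).card : ℝ)
      ((colorClass l M false).card : ℝ) a b * ((d : ℝ) - 1) := by
  have h₀ := hG.card_vertPairs_true_true
  have h₁ := G.card_vertPairs_add M true
  have h₂ := G.card_vertPairs_add M false
  have h₃ := G.card_vertPairs_comm M true false
  rw [h₀, zero_add] at h₁
  have h₁' : ((G.vertPairs M true false).card : ℝ) =
      ((colorClass l M true).card : ℝ) * ((d : ℝ) - 1) := by
    rw [h₁]; push_cast [hd]; ring
  have h₂' : ((G.vertPairs M false true).card : ℝ) + ((G.vertPairs M false false).card : ℝ) =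
      ((colorClass l M false).card : ℝ) * ((d : ℝ) - 1) := by
    rw [← Nat.cast_add, h₂]; push_cast [hd]; ring
  have h₃' : ((G.vertPairs M true false).card : ℝ) = ((G.vertPairs M false true).card : ℝ) := by
    rw [h₃]
  rcases a <;> rcases b <;> simp only [pairWeight]
  · linarith
  · linarith
  · linarith
  · rw [h₀]; simp

theorem card_filter_edgePairs_le (M : Finset (Fin m)) (a : Bool) (e : Fin m) :
    ((edgePairs l M a).filter fun p => p.1.1 = e).card ≤ l * l := by
  calc _ ≤ ((Finset.univ.filter fun x : HalfEdge l m => x.1 = e) ×ˢ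
        (Finset.univ.filter fun x : HalfEdge l m => x.1 = e)).card := by
        refine Finset.card_le_card fun p hp => ?_
        simp only [edgePairs, Finset.mem_filter, Finset.mem_univ, true_and,
          Finset.mem_product] at hp ⊢
        exact ⟨hp.2, hp.1.1 ▸ hp.2⟩
    _ = _ := by rw [Finset.card_product, card_filter_edge]

theorem card_filter_vertPairs_le (G : RegHypergraph d l m) (M : Finset (Fin m)) (a b : Bool)
    (v : Finset (HalfEdge l m)) :
    ((G.vertPairs M a b).filter fun p => G.vert p.1 = v).card ≤ d * d := by
  rcases Finset.eq_empty_or_nonempty ((G.vertPairs M a b).filter fun p => G.vert p.1 = v) with h | h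
  · simp [h]
  obtain ⟨q, hq⟩ := h
  calc _ ≤ (G.vert q.1 ×ˢ G.vert q.1).card := by
        refine Finset.card_le_card fun p hp => ?_
        simp only [vertPairs, Finset.mem_filter, Finset.mem_univ, true_and,
          Finset.mem_product, mem_vert_iff] at hp hq ⊢
        exact ⟨hp.2.trans hq.2.symm, hp.1.1 ▸ hp.2.trans hq.2.symm⟩
    _ = _ := by rw [Finset.card_product, card_vert]

/-- Place the half-edges of `M` in the zeroth slots of distinct vertices, extend to a bijection onto
`Fin n × Fin d`, and take the fibres of the first coordinate. -/
theorem exists_isMatching (hd : 1 ≤ d) (hdvd : d ∣ l * m) (M : Finset (Fin m))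
    (hM : d * (M.card * l) ≤ l * m) : ∃ G : RegHypergraph d l m, G.IsMatching M := by
  classical
  obtain ⟨n, hn⟩ := hdvd
  have hMn : (colorClass l M true).card ≤ n := by
    rw [card_colorClass_true]
    rw [hn] at hM
    exact Nat.le_of_mul_le_mul_left hM hd
  obtain ⟨ι, hι⟩ : ∃ ι : HalfEdge l m → Fin n × Fin d, Set.InjOn ι (colorClass l M true) ∧
      ∀ h, (ι h).2 = ⟨0, hd⟩ := by
    rcases Nat.eq_zero_or_pos n with rfl | hn0
    · have : IsEmpty (HalfEdge l m) := by
        rw [← Fintype.card_eq_zero_iff]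
        simp only [Fintype.card_prod, Fintype.card_fin]
        rw [mul_comm, hn, mul_zero]
      exact ⟨fun h => isEmptyElim h, fun h => isEmptyElim h, fun h => isEmptyElim h⟩
    · obtain ⟨f⟩ := Function.Embedding.nonempty_of_card_le
        (α := colorClass l M true) (β := Fin n) (by simpa using hMn)
      refine ⟨fun h => (if hh : h ∈ colorClass l M true then f ⟨h, hh⟩ else ⟨0, hn0⟩, ⟨0, hd⟩),
        fun x hx y hy h => ?_, by simp⟩
      have h' := (Prod.ext_iff.1 h).1
      simp only [dif_pos (Finset.mem_coe.1 hx), dif_pos (Finset.mem_coe.1 hy)] at h'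
      exact Subtype.ext_iff.1 (f.injective h')
  obtain ⟨g, hg⟩ := Finset.exists_equiv_extend_of_card_eq
    (t := (Finset.univ : Finset (Fin n × Fin d))) (by simp [mul_comm m l, hn, mul_comm n d])
    (s := colorClass l M true) (f := ι) (by simp) hι.1
  let e : HalfEdge l m ≃ Fin n × Fin d := g.trans (Equiv.subtypeUnivEquiv (by simp))
  have he : ∀ h ∈ colorClass l M true, e h = ι h := hg
  refine ⟨ofMap (fun h => (e h).1) fun h => ?_, ?_⟩
  · have : (Finset.univ.filter fun p : Fin n × Fin d => p.1 = (e h).1).card = d := by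
      have : (Finset.univ.filter fun p : Fin n × Fin d => p.1 = (e h).1) =
          {(e h).1} ×ˢ Finset.univ := by
        ext ⟨e, a⟩; simp only [Finset.mem_filter, Finset.mem_univ, true_and, Finset.mem_product,
          Finset.mem_singleton, and_true]
      rw [this, Finset.card_product]; simp
    refine Eq.trans ?_ this
    exact Finset.card_bij' (fun x _ => e x) (fun x _ => e.symm x) (by simp) (by simp) (by simp)
      (by simp)
  · rw [isMatching_iff]
    intro x y hxy hx hy
    rw [vert_ofMap] at hxy
    have hx' := he x (by simp [mem_colorClass, col, hx])
    have hy' := he y (by simp [mem_colorClass, col, hy])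
    apply e.injective
    refine Prod.ext hxy ?_
    rw [hx', hy', hι.2, hι.2]

end RegHypergraph

/-! ### Leading-order asymptotics of tuple counts. -/

theorem avg_const {Ω : Type*} {S : Finset Ω} (hS : S.Nonempty) (a : ℝ) :
    avg S (fun _ => a) = a := by
  have : (S.card : ℝ) ≠ 0 := by exact_mod_cast hS.card_pos.ne'
  unfold avg
  rw [Finset.sum_const, nsmul_eq_mul]
  field_simp

theorem tendsto_pow_sub_one_div_pow {m : ℕ → ℕ} (hm : Tendsto m atTop atTop) (t K C : ℕ) :
    Tendsto (fun j => ((t : ℝ) ^ 2 * (K * (C * (m j : ℝ)) ^ (t - 1))) / (m j : ℝ) ^ t) atTop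
      (𝓝 0) := by
  rcases Nat.eq_zero_or_pos t with rfl | ht
  · simp
  · obtain ⟨t, rfl⟩ := Nat.exists_eq_add_of_le' ht
    have h : Tendsto (fun j => (((t + 1 : ℕ) : ℝ) ^ 2 * (K * (C : ℝ) ^ t)) / (m j : ℝ)) atTop
        (𝓝 0) := tendsto_const_nhds.div_atTop (tendsto_natCast_atTop_atTop.comp hm)
    refine h.congr' ?_
    filter_upwards [hm.eventually_gt_atTop 0] with j hj
    have : (m j : ℝ) ≠ 0 := by exact_mod_cast hj.ne'
    rw [Nat.add_sub_cancel, mul_pow, pow_succ (m j : ℝ)]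
    field_simp

/-- The error has the shape supplied by `prod_card_le_card_injective_add` with `N` proportional to
`m j`; it vanishes after division by `m ^ t`, and for `t = 0` the factor `t ^ 2` removes it. -/
theorem tendsto_div_pow_of_le {m : ℕ → ℕ} (hm : Tendsto m atTop atTop) (t K C : ℕ)
    {N P : ℕ → ℝ} {p : ℝ} (h₁ : ∀ᶠ j in atTop, N j ≤ P j)
    (h₂ : ∀ᶠ j in atTop, P j ≤ N j + (t : ℝ) ^ 2 * (K * (C * (m j : ℝ)) ^ (t - 1)))
    (hP : Tendsto (fun j => P j / (m j : ℝ) ^ t) atTop (𝓝 p)) :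
    Tendsto (fun j => N j / (m j : ℝ) ^ t) atTop (𝓝 p) := by
  have h := hP.sub (tendsto_pow_sub_one_div_pow hm t K C)
  rw [sub_zero] at h
  refine tendsto_of_tendsto_of_tendsto_of_le_of_le' h hP ?_ ?_
  · filter_upwards [h₂] with j hj
    rw [← sub_div]
    gcongr
    linarith
  · filter_upwards [h₁] with j hj
    gcongr

theorem tendsto_prod_div_pow {I : Type*} [Fintype I] {m : ℕ → ℕ} (a : I → ℕ → ℝ) (p : I → ℝ)
    (h : ∀ i, Tendsto (fun j => a i j / (m j : ℝ)) atTop (𝓝 (p i))) :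
    Tendsto (fun j => (∏ i, a i j) / (m j : ℝ) ^ Fintype.card I) atTop (𝓝 (∏ i, p i)) := by
  refine (tendsto_finsetProd Finset.univ fun i _ => h i).congr fun j => ?_
  rw [Finset.prod_div_distrib, Finset.prod_const, Finset.card_univ]

/-! ### The expected number of circuits. -/

namespace RegHypergraph

section circuits

variable {d l m : ℕ} {I : Type*}

/-- The tuple `z` consists of closed walks: the half-edges `z (inl i)` and `z (inr i)` are different
half-edges of the same hyperedge, `z (inr i)` and `z (inl (s i))` are different half-edges at the
same vertex. -/
def IsWalk (G : RegHypergraph d l m) (s : Equiv.Perm I) (z : I ⊕ I → HalfEdge l m) : Prop :=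
  ∀ i, ((z (.inl i)).1 = (z (.inr i)).1 ∧ z (.inl i) ≠ z (.inr i)) ∧
    (G.vert (z (.inr i)) = G.vert (z (.inl (s i))) ∧ z (.inr i) ≠ z (.inl (s i)))

/-- The tuple `z` consists of closed walks and passes through each hyperedge and each vertex at most
once. -/
def IsCircuit (G : RegHypergraph d l m) (s : Equiv.Perm I) (z : I ⊕ I → HalfEdge l m) : Prop :=
  G.IsWalk s z ∧ Function.Injective (fun i => (z (.inl i)).1) ∧
    Function.Injective fun i => G.vert (z (.inl i))

/-- The set of all circuits with index set `I` and successor function `s`. -/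
noncomputable def circuits [Finite I] (G : RegHypergraph d l m) (s : Equiv.Perm I) :
    Finset (I ⊕ I → HalfEdge l m) :=
  (Set.toFinite {z | G.IsCircuit s z}).toFinset

theorem mem_circuits [Finite I] {G : RegHypergraph d l m} {s : Equiv.Perm I}
    {z : I ⊕ I → HalfEdge l m} : z ∈ G.circuits s ↔ G.IsCircuit s z := by
  simp [circuits]

/-- The pattern of incidences with the vertices in a circuit. -/
def IsCircuitPattern (s : Equiv.Perm I) (r : I ⊕ I → I ⊕ I → Prop) : Prop :=
  (∀ i, r (.inr i) (.inl (s i))) ∧ ∀ i j, r (.inl i) (.inl j) → i = j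

variable [Fintype I]

open scoped Classical in
/-- Tuples of pairs of half-edges of distinct hyperedges with prescribed colours. -/
noncomputable def edgeTuples (l : ℕ) {m : ℕ} (M : Finset (Fin m)) (τ : I → Bool) :
    Finset (I ⊕ I → HalfEdge l m) :=
  Finset.univ.filter fun z => (∀ i, (z (.inl i)).1 = (z (.inr i)).1 ∧ z (.inl i) ≠ z (.inr i) ∧
    col M (z (.inl i)) = τ i) ∧ Function.Injective fun i => (z (.inl i)).1

open scoped Classical in
/-- Tuples of distinct half-edges with prescribed colours. -/
noncomputable def injTuples {T : Type*} [Fintype T] (l : ℕ) {m : ℕ} (M : Finset (Fin m))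
    (τ : T → Bool) : Finset (T → HalfEdge l m) :=
  (Fintype.piFinset fun i => colorClass l M (τ i)).filter Function.Injective

theorem mem_injTuples {T : Type*} [Fintype T] {M : Finset (Fin m)} {τ : T → Bool}
    {z : T → HalfEdge l m} :
    z ∈ injTuples l M τ ↔ (∀ i, col M (z i) = τ i) ∧ Function.Injective z := by
  simp [injTuples, mem_colorClass]

theorem edgeTuples_subset (M : Finset (Fin m)) (τ : I → Bool) :
    edgeTuples l M τ ⊆ injTuples l M (Sum.elim τ τ) := by
  intro z hz
  simp only [edgeTuples, Finset.mem_filter, Finset.mem_univ, true_and] at hz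
  rw [mem_injTuples]
  obtain ⟨h₁, h₂⟩ := hz
  refine ⟨?_, ?_⟩
  · rintro (i | i)
    · exact (h₁ i).2.2
    · rw [Sum.elim_inr, ← (h₁ i).2.2]
      simp [col, (h₁ i).1]
  · have key : ∀ i j, (z (.inl i)).1 = (z (.inl j)).1 → i = j := fun i j h => h₂ h
    rintro (i | i) (j | j) h
    · rw [key i j (congrArg Prod.fst h)]
    · have := key i j ((congrArg Prod.fst h).trans (h₁ j).1.symm)
      subst this
      exact absurd h (h₁ i).2.1
    · have := key i j ((h₁ i).1.trans (congrArg Prod.fst h))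
      subst this
      exact absurd h.symm (h₁ i).2.1
    · rw [key i j ((h₁ i).1.trans ((congrArg Prod.fst h).trans (h₁ j).1.symm))]

-- Here the tuple is regrouped into its pairs at hyperedges; `card_filter_injTuples` regroups it
-- into pairs at vertices, joining `inr i` to `inl (s i)`.
open scoped Classical in
theorem card_edgeTuples (M : Finset (Fin m)) (τ : I → Bool) :
    (edgeTuples l M τ).card = ((Fintype.piFinset fun i => edgePairs l M (τ i)).filter
      fun f => Function.Injective fun i => (f i).1.1).card := by
  refine Finset.card_bij' (fun z _ i => (z (.inl i), z (.inr i)))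
    (fun f _ => Sum.elim (fun i => (f i).1) (fun i => (f i).2)) ?_ ?_ ?_ ?_
  · intro z hz
    simpa [edgeTuples, edgePairs] using hz
  · intro z hz
    simpa [edgeTuples, edgePairs] using hz
  · intro z _; ext (i | i) <;> rfl
  · intro z _; rfl

open scoped Classical in
theorem card_filter_injTuples (G : RegHypergraph d l m) (s : Equiv.Perm I) (M : Finset (Fin m))
    (τ : I → Bool) :
    ((injTuples l M (Sum.elim τ τ)).filter fun z =>
      IsCircuitPattern s fun i j => G.vert (z i) = G.vert (z j)).card =
    ((Fintype.piFinset fun i => G.vertPairs M (τ i) (τ (s i))).filter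
      fun f => Function.Injective fun i => G.vert (f i).1).card := by
  refine Finset.card_bij' (fun z _ i => (z (.inr i), z (.inl (s i))))
    (fun f _ => Sum.elim (fun i => (f (s.symm i)).2) (fun i => (f i).1)) ?_ ?_ ?_ ?_
  · intro z hz
    rw [Finset.mem_filter, mem_injTuples] at hz
    simp only [Finset.mem_filter, Fintype.mem_piFinset, vertPairs, Finset.mem_univ, true_and]
    obtain ⟨⟨h₁, h₂⟩, h₃, h₄⟩ := hz
    refine ⟨fun i => ⟨h₃ i, fun h => by simpa using h₂ h, h₁ _, h₁ _⟩, fun i j h => ?_⟩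
    have : G.vert (z (.inr i)) = G.vert (z (.inr j)) := h
    rw [h₃, h₃] at this
    exact s.injective (h₄ _ _ this)
  · intro f hf
    rw [Finset.mem_filter, mem_injTuples]
    simp only [Finset.mem_filter, Fintype.mem_piFinset, vertPairs, Finset.mem_univ, true_and] at hf
    obtain ⟨h₁, h₂⟩ := hf
    have key : ∀ i j, G.vert (f i).1 = G.vert (f j).1 → i = j := fun i j h => h₂ h
    refine ⟨⟨?_, ?_⟩, ?_, ?_⟩
    · rintro (i | i)
      · simpa using (h₁ (s.symm i)).2.2.2
      · exact (h₁ i).2.2.1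
    · rintro (i | i) (j | j) h
      · simp only [Sum.elim_inl] at h
        have := key (s.symm i) (s.symm j) (by rw [(h₁ _).1, h, ← (h₁ _).1])
        rw [s.symm.injective this]
      · simp only [Sum.elim_inl, Sum.elim_inr] at h
        have := key (s.symm i) j (by rw [(h₁ _).1, h])
        rw [this] at h
        exact absurd h.symm (h₁ j).2.1
      · simp only [Sum.elim_inl, Sum.elim_inr] at h
        have := key i (s.symm j) (by rw [h, ← (h₁ _).1])
        rw [← this] at h
        exact absurd h (h₁ i).2.1
      · simp only [Sum.elim_inr] at h
        rw [key i j (by rw [h])]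
    · intro i; simpa using (h₁ i).1
    · intro i j h
      simp only [Sum.elim_inl] at h
      exact s.symm.injective (key _ _ (by rw [(h₁ _).1, h, ← (h₁ _).1]))
  · intro z _; ext (i | i) <;> simp
  · intro f _; ext i <;> simp

-- This separates the hyperedge condition, which does not involve `G`, from the vertex pattern, to
-- which the exchange identity applies. The colours of `inr i` and `inl i` agree since they share a
-- hyperedge.
open scoped Classical in
theorem card_circuits [DecidableEq I] (G : RegHypergraph d l m) (s : Equiv.Perm I) (M : Finset (Fin m)) :
    (G.circuits s).card = ∑ τ : I → Bool, ((edgeTuples l M τ).filter fun z =>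
      IsCircuitPattern s fun i j => G.vert (z i) = G.vert (z j)).card := by
  rw [Finset.card_eq_sum_card_fiberwise (f := fun z i => col M (z (.inl i))) (t := Finset.univ)
    (by simp)]
  refine Finset.sum_congr rfl fun τ _ => ?_
  congr 1
  ext z
  simp only [Finset.mem_filter, mem_circuits]
  constructor
  · rintro ⟨⟨h₁, h₂, h₃⟩, rfl⟩
    refine ⟨?_, fun i => (h₁ i).2.1, fun i j h => h₃ h⟩
    simp only [edgeTuples, Finset.mem_filter, Finset.mem_univ, true_and]
    exact ⟨fun i => ⟨(h₁ i).1.1, (h₁ i).1.2, trivial⟩, h₂⟩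
  · rintro ⟨h₁, h₂⟩
    have hinj := (mem_injTuples.1 (edgeTuples_subset M τ h₁)).2
    simp only [edgeTuples, Finset.mem_filter, Finset.mem_univ, true_and] at h₁
    exact ⟨⟨fun i => ⟨⟨(h₁.1 i).1, (h₁.1 i).2.1⟩, h₂.1 i, fun h => by simpa using hinj h⟩,
      h₁.2, fun i j h => h₂.2 i j h⟩, funext fun i => (h₁.1 i).2.2⟩

end circuits

/-- A sequence of sets `M j` of hyperedges, of asymptotic density `β`, that may be matchings of
`(d, l)`-regular hypergraphs with `m j` hyperedges. -/
structure IsAdmissible (d l : ℕ) (m : ℕ → ℕ) (M : ∀ j, Finset (Fin (m j))) (β : ℝ) : Prop where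
  two_le_d : 2 ≤ d
  two_le_l : 2 ≤ l
  tendsto_m : Tendsto m atTop atTop
  dvd : ∀ j, d ∣ l * m j
  nonneg : 0 ≤ β
  lt : β < 1 / (d : ℝ)
  tendsto_card : Tendsto (fun j => ((M j).card : ℝ) / (m j : ℝ)) atTop (𝓝 β)
  eq_empty : β = 0 → ∀ j, M j = ∅

/-- The asymptotic frequency of the colours. -/
def colorFreq (β : ℝ) : Bool → ℝ
  | true => β
  | false => 1 - β

/-- The asymptotic ratio for the transition from colour `a` to colour `b` at a vertex. -/
noncomputable def transition (β : ℝ) (a b : Bool) : ℝ :=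
  pairWeight β (1 - β) a b / colorFreq β a

namespace IsAdmissible

variable {d l : ℕ} {m : ℕ → ℕ} {M : ∀ j, Finset (Fin (m j))} {β : ℝ}

theorem lt_half (h : IsAdmissible d l m M β) : β < 1 / 2 := by
  refine h.lt.trans_le ?_
  have : (2 : ℝ) ≤ d := by exact_mod_cast h.two_le_d
  gcongr

theorem eventually_pos (h : IsAdmissible d l m M β) : ∀ᶠ j in atTop, (0 : ℝ) < m j := by
  filter_upwards [h.tendsto_m.eventually_gt_atTop 0] with j hj
  exact_mod_cast hj

theorem tendsto_colorClass (h : IsAdmissible d l m M β) (a : Bool) :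
    Tendsto (fun j => ((colorClass l (M j) a).card : ℝ) / (m j : ℝ)) atTop
      (𝓝 (l * colorFreq β a)) := by
  have ht : Tendsto (fun j => ((colorClass l (M j) true).card : ℝ) / (m j : ℝ)) atTop
      (𝓝 (l * β)) := by
    refine (h.tendsto_card.const_mul (l : ℝ)).congr fun j => ?_
    rw [card_colorClass_true]; push_cast; ring
  cases a
  · have : (l : ℝ) * colorFreq β false = l - l * β := by simp only [colorFreq]; ring
    rw [this]
    refine (tendsto_const_nhds.sub ht).congr' ?_
    filter_upwards [h.eventually_pos] with j hj
    have e : ((colorClass l (M j) true).card : ℝ) + ((colorClass l (M j) false).card : ℝ) =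
      m j * l := by exact_mod_cast card_colorClass_add (l := l) (M j)
    field_simp
    linarith
  · exact ht

/-- This is where `β < 1/d` enters: eventually `d |M| < m`, so there is room for the matching. -/
theorem eventually_nonempty (h : IsAdmissible d l m M β) :
    ∀ᶠ j in atTop, (matchingSet d l (M j)).Nonempty := by
  filter_upwards [h.tendsto_card.eventually_lt_const h.lt, h.eventually_pos] with j hj hm
  have hd : (0 : ℝ) < d := by exact_mod_cast (by linarith [h.two_le_d] : 0 < d)
  rw [div_lt_div_iff₀ hm hd, one_mul] at hj
  have hj' : (M j).card * d < m j := by exact_mod_cast hj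
  obtain ⟨G, hG⟩ := exists_isMatching (by linarith [h.two_le_d]) (h.dvd j) (M j)
    (by nlinarith)
  exact ⟨G, mem_matchingSet.2 hG⟩

variable {I : Type*} [Fintype I]

theorem tendsto_injTuples {T : Type*} [Fintype T] (h : IsAdmissible d l m M β) (τ : T → Bool) :
    Tendsto (fun j => ((injTuples l (M j) τ).card : ℝ) / (m j : ℝ) ^ Fintype.card T) atTop
      (𝓝 (∏ i, (l * colorFreq β (τ i)))) := by
  classical
  refine tendsto_div_pow_of_le h.tendsto_m (Fintype.card T) 1 l
    (P := fun j => ∏ i, ((colorClass l (M j) (τ i)).card : ℝ)) ?_ ?_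
    (tendsto_prod_div_pow _ _ fun i => h.tendsto_colorClass (τ i))
  · refine .of_forall fun j => ?_
    rw [← Nat.cast_prod, ← Fintype.card_piFinset]
    exact_mod_cast Finset.card_filter_le _ _
  · refine .of_forall fun j => ?_
    have := prod_card_le_card_injective_add (fun i => colorClass l (M j) (τ i)) (fun x => x) 1 (l * m j)
      (fun i b => by
        refine Finset.card_le_one.2 fun x hx y hy => ?_
        rw [Finset.mem_filter] at hx hy
        rw [hx.2, hy.2])
      (fun i => by rw [mul_comm]; exact card_colorClass_le _ _)
    unfold injTuples
    exact_mod_cast this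

theorem tendsto_edgeTuples (h : IsAdmissible d l m M β) (τ : I → Bool) :
    Tendsto (fun j => ((edgeTuples l (M j) τ).card : ℝ) / (m j : ℝ) ^ Fintype.card I) atTop
      (𝓝 (∏ i, (l * colorFreq β (τ i) * ((l : ℝ) - 1)))) := by
  classical
  have hl : 1 ≤ l := by linarith [h.two_le_l]
  refine tendsto_div_pow_of_le h.tendsto_m (Fintype.card I) (l * l) (l * l)
    (P := fun j => ∏ i, ((edgePairs l (M j) (τ i)).card : ℝ)) ?_ ?_
    (tendsto_prod_div_pow _ _ fun i => ?_)
  · refine .of_forall fun j => ?_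
    rw [← Nat.cast_prod, ← Fintype.card_piFinset, card_edgeTuples]
    exact_mod_cast Finset.card_filter_le _ _
  · refine .of_forall fun j => ?_
    have := prod_card_le_card_injective_add (fun i => edgePairs l (M j) (τ i)) (fun p => p.1.1)
      (l * l) (l * l * m j)
      (fun i b => card_filter_edgePairs_le _ _ _)
      (fun i => by
        rw [card_edgePairs]
        calc _ ≤ m j * l * l := Nat.mul_le_mul (card_colorClass_le _ _) (Nat.sub_le _ _)
          _ = _ := by ring)
    rw [card_edgeTuples]
    exact_mod_cast this
  · refine ((h.tendsto_colorClass (τ i)).mul_const ((l : ℝ) - 1)).congr fun j => ?_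
    rw [card_edgePairs]
    push_cast [hl]
    ring

-- The product of vertex-pair counts has one value `P j` for all admissible `G`; averaging therefore
-- changes only the collision error.
open scoped Classical in
theorem tendsto_avg_filter_injTuples (h : IsAdmissible d l m M β) (s : Equiv.Perm I)
    (τ : I → Bool) :
    Tendsto (fun j => (avg (matchingSet d l (M j)) fun G =>
      (((injTuples l (M j) (Sum.elim τ τ)).filter fun z =>
        IsCircuitPattern s fun i j => G.vert (z i) = G.vert (z j)).card : ℝ)) /
          (m j : ℝ) ^ Fintype.card I) atTop
      (𝓝 (∏ i, (l * pairWeight β (1 - β) (τ i) (τ (s i)) * ((d : ℝ) - 1)))) := by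
  have hd : 1 ≤ d := by linarith [h.two_le_d]
  set P : ℕ → ℝ := fun j => ∏ i, (pairWeight ((colorClass l (M j) true).card : ℝ)
      ((colorClass l (M j) false).card : ℝ) (τ i) (τ (s i)) * ((d : ℝ) - 1)) with hP
  have hPG : ∀ j, ∀ G ∈ matchingSet d l (M j),
      ∏ i, ((G.vertPairs (M j) (τ i) (τ (s i))).card : ℝ) = P j := fun j G hG =>
    Finset.prod_congr rfl fun i _ => (mem_matchingSet.1 hG).card_vertPairs hd _ _
  refine tendsto_div_pow_of_le h.tendsto_m (Fintype.card I) (d * d) (l * d)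
    (P := P) ?_ ?_ (tendsto_prod_div_pow _ _ fun i => ?_)
  · filter_upwards [h.eventually_nonempty] with j hj
    refine le_of_le_of_eq (avg_mono _ fun G hG => ?_) (avg_const hj (P j))
    rw [← hPG j G hG, ← Nat.cast_prod, ← Fintype.card_piFinset, card_filter_injTuples]
    exact_mod_cast Finset.card_filter_le _ _
  · filter_upwards [h.eventually_nonempty] with j hj
    rw [← sub_le_iff_le_add]
    refine le_of_eq_of_le (avg_const hj _).symm (avg_mono _ fun G hG => ?_)
    rw [sub_le_iff_le_add, ← hPG j G hG, card_filter_injTuples]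
    have := prod_card_le_card_injective_add (fun i => G.vertPairs (M j) (τ i) (τ (s i)))
      (fun p => G.vert p.1) (d * d) (l * d * m j)
      (fun i b => G.card_filter_vertPairs_le _ _ _ _)
      (fun i => by
        have h₁ := G.card_vertPairs_add (M j) (τ i)
        have h₂ : (colorClass l (M j) (τ i)).card * (d - 1) ≤ l * d * m j :=
          calc _ ≤ m j * l * d := Nat.mul_le_mul (card_colorClass_le _ _) (Nat.sub_le _ _)
            _ = _ := by ring
        cases τ (s i) <;> omega)
    exact_mod_cast this
  · have ht := h.tendsto_colorClass true
    have hf := h.tendsto_colorClass false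
    simp only [mul_div_right_comm _ ((d : ℝ) - 1)]
    refine Tendsto.mul_const _ ?_
    cases τ i <;> cases τ (s i) <;> simp only [pairWeight, colorFreq, sub_div, mul_sub] at ht hf ⊢
    · exact hf.sub ht
    · exact ht
    · exact ht
    · simp

/-- The expected number of circuits. -/
theorem tendsto_avg_card_circuits [DecidableEq I] (h : IsAdmissible d l m M β) (s : Equiv.Perm I) :
    Tendsto (fun j => avg (matchingSet d l (M j)) fun G => ((G.circuits s).card : ℝ)) atTop
      (𝓝 ((((d : ℝ) - 1) * ((l : ℝ) - 1)) ^ Fintype.card I *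
        ∑ τ : I → Bool, ∏ i, transition β (τ i) (τ (s i)))) := by
  classical
  have hl : (0 : ℝ) < l := by exact_mod_cast (by linarith [h.two_le_l] : 0 < l)
  have e : ∀ j, (avg (matchingSet d l (M j)) fun G => ((G.circuits s).card : ℝ)) =
      ∑ τ : I → Bool, avg (matchingSet d l (M j)) fun G =>
        (((edgeTuples l (M j) τ).filter fun z =>
          IsCircuitPattern s fun i j => G.vert (z i) = G.vert (z j)).card : ℝ) := by
    intro j
    rw [← avg_sum]
    refine avg_congr _ fun G _ => ?_
    rw [card_circuits G s (M j)]
    push_cast; rfl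
  rw [funext e, Finset.mul_sum]
  refine tendsto_finsetSum _ fun τ _ => ?_
  have hfalse : 0 < colorFreq β false := by simp only [colorFreq]; linarith [h.lt_half]
  -- Only the colour `true` at `β = 0` has frequency zero. Then `M j` is empty, no such tuples
  -- exist, and the limit is `0` because `transition` divides by zero.
  by_cases hτ : ∃ i, colorFreq β (τ i) = 0
  · obtain ⟨i, hi⟩ := hτ
    have hti : τ i = true := by
      by_contra hne
      rw [Bool.not_eq_true] at hne
      rw [hne] at hi
      exact hfalse.ne' hi
    have hβ : β = 0 := by rw [hti] at hi; exact hi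
    rw [Finset.prod_eq_zero (Finset.mem_univ i) (by rw [transition, hi, div_zero]), mul_zero]
    refine tendsto_const_nhds.congr fun j => ?_
    have : edgeTuples l (M j) τ = ∅ := by
      rw [Finset.eq_empty_iff_forall_notMem]
      intro z hz
      simp only [edgeTuples, Finset.mem_filter, Finset.mem_univ, true_and] at hz
      have := (hz.1 i).2.2
      rw [hti] at this
      simp [col, h.eq_empty hβ j] at this
    simp [this, avg]
  · push Not at hτ
    have hne : (∏ i : I ⊕ I, ((l : ℝ) * colorFreq β (Sum.elim τ τ i))) ≠ 0 := by
      rw [Finset.prod_ne_zero_iff]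
      rintro (i | i) -
      · exact mul_ne_zero hl.ne' (hτ i)
      · exact mul_ne_zero hl.ne' (hτ i)
    have lim := ((h.tendsto_edgeTuples τ).mul (h.tendsto_avg_filter_injTuples s τ)).div
      (h.tendsto_injTuples (Sum.elim τ τ)) hne
    have hlim : (∏ i, (l * colorFreq β (τ i) * ((l : ℝ) - 1))) *
        (∏ i, (l * pairWeight β (1 - β) (τ i) (τ (s i)) * ((d : ℝ) - 1))) /
          (∏ i : I ⊕ I, ((l : ℝ) * colorFreq β (Sum.elim τ τ i))) =
        (((d : ℝ) - 1) * ((l : ℝ) - 1)) ^ Fintype.card I *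
          ∏ i, transition β (τ i) (τ (s i)) := by
      rw [Fintype.prod_sum_type, ← Finset.card_univ, ← Finset.prod_const]
      simp only [Sum.elim_inl, Sum.elim_inr]
      rw [← Finset.prod_mul_distrib, ← Finset.prod_mul_distrib, ← Finset.prod_mul_distrib,
        ← Finset.prod_div_distrib]
      refine Finset.prod_congr rfl fun i _ => ?_
      have := hτ i
      rw [transition]
      field_simp
    rw [← hlim]
    refine lim.congr' ?_
    filter_upwards [h.eventually_pos, (h.tendsto_injTuples (Sum.elim τ τ)).eventually_ne hne,
      h.eventually_nonempty] with j hj hne' hnon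
    have hcard : ((injTuples l (M j) (Sum.elim τ τ)).card : ℝ) ≠ 0 := by
      intro h0; rw [h0, zero_div] at hne'; exact hne' rfl
    have hS : ((matchingSet d l (M j)).card : ℝ) ≠ 0 := by exact_mod_cast hnon.card_pos.ne'
    -- Exchange between tuples fitting the hyperedges and arbitrary distinct tuples; both have
    -- trivial coincidences and colours `Sum.elim τ τ`.
    have key := sum_card_filter_mul_card (d := d) (M j) (IsCircuitPattern s) (edgeTuples l (M j) τ)
      (injTuples l (M j) (Sum.elim τ τ))
      (fun z hz w hw i j => by
        rw [(mem_injTuples.1 (edgeTuples_subset _ _ hz)).2.eq_iff, (mem_injTuples.1 hw).2.eq_iff])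
      (fun z hz w hw i => by
        rw [(mem_injTuples.1 (edgeTuples_subset _ _ hz)).1 i, (mem_injTuples.1 hw).1 i])
    have key' : (∑ G ∈ matchingSet d l (M j), (((edgeTuples l (M j) τ).filter fun z =>
          IsCircuitPattern s fun i j => G.vert (z i) = G.vert (z j)).card : ℝ)) *
          ((injTuples l (M j) (Sum.elim τ τ)).card : ℝ) = ((edgeTuples l (M j) τ).card : ℝ) *
        ∑ G ∈ matchingSet d l (M j), (((injTuples l (M j) (Sum.elim τ τ)).filter fun z =>
          IsCircuitPattern s fun i j => G.vert (z i) = G.vert (z j)).card : ℝ) := by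
      exact_mod_cast key
    simp only [Pi.div_apply]
    rw [Fintype.card_sum, pow_add, avg, avg]
    field_simp
    linarith [key']

end IsAdmissible

end RegHypergraph

/-! ### Crowded walks are rare. -/

theorem two_mul_card_image_le {α β : Type*} [DecidableEq α] [DecidableEq β] (U : Finset α)
    (g : α → β) (h : ∀ a ∈ U, ∃ b ∈ U, b ≠ a ∧ g b = g a) : 2 * (U.image g).card ≤ U.card := by
  rw [Finset.card_eq_sum_card_image g U, mul_comm, ← smul_eq_mul]
  refine Finset.card_nsmul_le_sum _ _ _ fun x hx => ?_
  obtain ⟨a, ha, rfl⟩ := Finset.mem_image.1 hx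
  obtain ⟨b, hb, hne, hab⟩ := h a ha
  exact Finset.one_lt_card.2 ⟨b, by simp [hb, hab], a, by simp [ha], hne⟩

theorem two_mul_card_image_lt {α β : Type*} [DecidableEq α] [DecidableEq β] (U : Finset α)
    (g : α → β) (h : ∀ a ∈ U, ∃ b ∈ U, b ≠ a ∧ g b = g a) {x y z : α} (hx : x ∈ U) (hy : y ∈ U)
    (hz : z ∈ U) (hxy : x ≠ y) (hyz : y ≠ z) (hxz : x ≠ z) (gxy : g x = g y) (gyz : g y = g z) :
    2 * (U.image g).card < U.card := by
  rw [Finset.card_eq_sum_card_image g U, mul_comm, ← smul_eq_mul, ← Finset.sum_const]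
  refine Finset.sum_lt_sum (fun w hw => ?_) ⟨g x, Finset.mem_image_of_mem g hx, ?_⟩
  · obtain ⟨a, ha, rfl⟩ := Finset.mem_image.1 hw
    obtain ⟨b, hb, hne, hab⟩ := h a ha
    exact Finset.one_lt_card.2 ⟨b, by simp [hb, hab], a, by simp [ha], hne⟩
  · exact Finset.two_lt_card.2 ⟨x, by simp [hx], y, by simp [hy, gxy], z,
      by simp [hz, gxy, gyz], hxy, hxz, hyz⟩

theorem natCard_quotient_ker {W α : Type*} [Fintype W] [DecidableEq α] (f : W → α) :
    Nat.card (Quotient (Setoid.ker f)) = (Finset.univ.image f).card := by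
  rw [Nat.card_congr (Setoid.quotientKerEquivRange f), ← Set.ncard_coe_finset, Finset.coe_image,
    Finset.coe_univ, Set.image_univ]
  rfl

instance {W : Type*} [Finite W] : Finite (Setoid W) :=
  Finite.of_injective (fun r : Setoid W => (r : W → W → Prop)) fun _ _ h =>
    Setoid.ext fun a b => iff_of_eq (congrFun (congrFun h a) b)

namespace RegHypergraph

section

variable {d l m : ℕ}

/-- The tuple `z` contains three half-edges of one hyperedge or of one vertex. -/
def IsCrowded {W : Type*} (G : RegHypergraph d l m) (z : W → HalfEdge l m) : Prop :=
  ∃ i j k, z i ≠ z j ∧ z j ≠ z k ∧ z i ≠ z k ∧ (((z i).1 = (z j).1 ∧ (z j).1 = (z k).1) ∨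
    (G.vert (z i) = G.vert (z j) ∧ G.vert (z j) = G.vert (z k)))

theorem IsWalk.exists_edge {I : Type*} {G : RegHypergraph d l m} {s : Equiv.Perm I}
    {z : I ⊕ I → HalfEdge l m} (hz : G.IsWalk s z) (w : I ⊕ I) :
    ∃ w', z w' ≠ z w ∧ (z w').1 = (z w).1 := by
  rcases w with i | i
  · exact ⟨.inr i, (hz i).1.2.symm, (hz i).1.1.symm⟩
  · exact ⟨.inl i, (hz i).1.2, (hz i).1.1⟩

theorem IsWalk.exists_vert {I : Type*} {G : RegHypergraph d l m} {s : Equiv.Perm I}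
    {z : I ⊕ I → HalfEdge l m} (hz : G.IsWalk s z) (w : I ⊕ I) :
    ∃ w', z w' ≠ z w ∧ G.vert (z w') = G.vert (z w) := by
  rcases w with i | i
  · have := hz (s.symm i)
    rw [Equiv.apply_symm_apply] at this
    exact ⟨.inr (s.symm i), this.2.2, this.2.1⟩
  · exact ⟨.inl (s i), (hz i).2.2.symm, (hz i).2.1.symm⟩

/-- A tuple of closed walks that is not a disjoint union of cycles spans more half-edges than
hyperedges and vertices. -/
theorem IsWalk.card_lt {I : Type*} [Finite I] {G : RegHypergraph d l m} {s : Equiv.Perm I}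
    {z : I ⊕ I → HalfEdge l m} (hz : G.IsWalk s z) (hc : G.IsCrowded z) :
    Nat.card (Quotient (Setoid.ker fun w => (z w).1)) +
      Nat.card (Quotient (Setoid.ker fun w => G.vert (z w))) <
        Nat.card (Quotient (Setoid.ker z)) := by
  classical
  have := Fintype.ofFinite I
  rw [natCard_quotient_ker, natCard_quotient_ker, natCard_quotient_ker]
  set U := Finset.univ.image z with hU
  have hUm : ∀ w, z w ∈ U := fun w => Finset.mem_image_of_mem z (Finset.mem_univ w)
  have e₁ : (Finset.univ.image fun w => (z w).1) = U.image fun h => h.1 := by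
    rw [hU, Finset.image_image]; rfl
  have e₂ : (Finset.univ.image fun w => G.vert (z w)) = U.image G.vert := by
    rw [hU, Finset.image_image]; rfl
  rw [e₁, e₂]
  have h₁ : ∀ a ∈ U, ∃ b ∈ U, b ≠ a ∧ b.1 = a.1 := by
    intro a ha
    obtain ⟨w, -, rfl⟩ := Finset.mem_image.1 ha
    obtain ⟨w', h, h'⟩ := hz.exists_edge w
    exact ⟨z w', hUm w', h, h'⟩
  have h₂ : ∀ a ∈ U, ∃ b ∈ U, b ≠ a ∧ G.vert b = G.vert a := by
    intro a ha
    obtain ⟨w, -, rfl⟩ := Finset.mem_image.1 ha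
    obtain ⟨w', h, h'⟩ := hz.exists_vert w
    exact ⟨z w', hUm w', h, h'⟩
  -- Every hyperedge and every vertex met by the walk contains at least two of its half-edges, so
  -- each kind numbers at most half of `U`; crowding makes one of the two bounds strict.
  have k₁ := two_mul_card_image_le U (fun h => h.1) h₁
  have k₂ := two_mul_card_image_le U G.vert h₂
  obtain ⟨i, j, k, hij, hjk, hik, ⟨h, h'⟩ | ⟨h, h'⟩⟩ := hc
  · have := two_mul_card_image_lt U (fun h => h.1) h₁ (hUm i) (hUm j) (hUm k) hij hjk hik h h'
    omega
  · have := two_mul_card_image_lt U G.vert h₂ (hUm i) (hUm j) (hUm k) hij hjk hik h h'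
    omega

variable {W : Type*} [Fintype W]

open scoped Classical in
/-- Tuples of half-edges with prescribed coincidences and colours. -/
noncomputable def patternTuples (l : ℕ) {m : ℕ} (M : Finset (Fin m)) (κ : Setoid W)
    (τ : W → Bool) : Finset (W → HalfEdge l m) :=
  Finset.univ.filter fun z => Setoid.ker z = κ ∧ ∀ i, col M (z i) = τ i

theorem mem_patternTuples {M : Finset (Fin m)} {κ : Setoid W} {τ : W → Bool}
    {z : W → HalfEdge l m} :
    z ∈ patternTuples l M κ τ ↔ Setoid.ker z = κ ∧ ∀ i, col M (z i) = τ i := by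
  simp [patternTuples]

/-- The lower bound for the denominator in the exchange: an injective tuple on the classes pulls
back to one with coincidences exactly `κ`. -/
theorem card_injTuples_le_patternTuples {κ : Setoid W} [Fintype (Quotient κ)] (M : Finset (Fin m))
    {τ : W → Bool} (hτ : ∀ i j, κ i j → τ i = τ j) :
    (injTuples l M fun c : Quotient κ => τ c.out).card ≤ (patternTuples l M κ τ).card := by
  refine Finset.card_le_card_of_injOn (fun u i => u (Quotient.mk κ i)) ?_ ?_
  · intro u hu
    rw [Finset.mem_coe, mem_injTuples] at hu
    rw [Finset.mem_coe, mem_patternTuples]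
    refine ⟨?_, fun i => ?_⟩
    · ext i j
      rw [Setoid.ker_def, hu.2.eq_iff, Quotient.eq]
    · rw [hu.1]
      exact hτ _ _ (Quotient.mk_out i)
  · intro u _ u' _ h
    funext c
    induction c using Quotient.inductionOn with
    | h i => exact congrFun h i

end

namespace IsAdmissible

variable {d l : ℕ} {m : ℕ → ℕ} {M : ∀ j, Finset (Fin (m j))} {β : ℝ} {W : Type*} [Fintype W]

-- By the exchange the average is `|A|` times an averaged count in `B`, divided by `|B|`. These have
-- orders at most `m ^ |ρ₁|` and `m ^ |ρ₂|`, and at least `m ^ |κ|`, with bars denoting numbers of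
-- classes.
open scoped Classical in
theorem tendsto_avg_pattern (h : IsAdmissible d l m M β) (κ ρ₁ ρ₂ : Setoid W) (τ : W → Bool)
    (hlt : Nat.card (Quotient ρ₁) + Nat.card (Quotient ρ₂) < Nat.card (Quotient κ)) :
    Tendsto (fun j => avg (matchingSet d l (M j)) fun G =>
      (((patternTuples l (M j) κ τ).filter fun z => (Setoid.ker fun w => (z w).1) = ρ₁ ∧
        (Setoid.ker fun w => G.vert (z w)) = ρ₂).card : ℝ)) atTop (𝓝 0) := by
  by_cases hne : ∀ j, patternTuples l (M j) κ τ = ∅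
  · refine tendsto_const_nhds.congr fun j => ?_
    simp [hne j, avg]
  push Not at hne
  -- One realisation of the pattern shows that `τ` is constant on classes of `κ` and uses only
  -- colours of positive frequency.
  obtain ⟨j₀, z₀, hz₀⟩ := hne
  rw [mem_patternTuples] at hz₀
  obtain ⟨rfl, hz₀⟩ := hz₀
  set κ := Setoid.ker z₀
  have hτ : ∀ i j, κ i j → τ i = τ j := by
    intro i j hij
    rw [← hz₀, ← hz₀, show z₀ i = z₀ j from hij]
  have hfreq : ∀ i, 0 < colorFreq β (τ i) := by
    intro i
    cases hi : τ i
    · simp only [colorFreq]; linarith [h.lt_half]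
    · refine h.nonneg.lt_of_ne fun h0 => ?_
      have := hz₀ i
      rw [hi] at this
      simp [col, h.eq_empty h0.symm j₀] at this
  have hl : (0 : ℝ) < l := by exact_mod_cast (by linarith [h.two_le_l] : 0 < l)
  have hpos : 0 < ∏ c : Quotient κ, ((l : ℝ) * colorFreq β (τ c.out)) :=
    Finset.prod_pos fun c _ => mul_pos hl (hfreq _)
  have hinj := h.tendsto_injTuples fun c : Quotient κ => τ c.out
  set c₁ := Fintype.card (Quotient ρ₁)
  set c₂ := Fintype.card (Quotient ρ₂)
  set t := Fintype.card (Quotient κ)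
  set N : ℕ → ℝ := fun j => ((injTuples l (M j) fun c : Quotient κ => τ c.out).card : ℝ)
  set w := Fintype.card W
  have hct : c₁ + c₂ < t := by simpa only [Nat.card_eq_fintype_card] using hlt
  have hm : Tendsto (fun j => (m j : ℝ)) atTop atTop :=
    tendsto_natCast_atTop_atTop.comp h.tendsto_m
  have hlim := (((tendsto_pow_div_pow_atTop_zero hct).comp hm).const_mul
    ((l : ℝ) ^ w * l ^ c₁ * (d ^ w * l ^ c₂))).div hinj hpos.ne'
  rw [mul_zero, zero_div] at hlim
  refine squeeze_zero' (.of_forall fun j => avg_nonneg _ fun _ _ => Nat.cast_nonneg _) ?_ hlim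
  filter_upwards [h.eventually_pos, hinj.eventually_const_lt hpos, h.eventually_nonempty]
    with j hj hNj hS
  have hN : 0 < N j := by
    by_contra hN
    exact absurd hNj (not_lt.2 (div_nonpos_of_nonpos_of_nonneg (not_lt.1 hN) (by positivity)))
  set A := (patternTuples l (M j) κ τ).filter fun z => (Setoid.ker fun w => (z w).1) = ρ₁ with hA
  set B := patternTuples l (M j) κ τ with hB
  have hNB : N j ≤ (B.card : ℝ) := by
    exact Nat.cast_le.2 (card_injTuples_le_patternTuples (M j) hτ)
  have hker : ∀ z ∈ B, ∀ w ∈ B, ∀ i j, z i = z j ↔ w i = w j := by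
    intro z hz w hw i j
    rw [hB, mem_patternTuples] at hz hw
    rw [← Setoid.ker_def, hz.1, ← hw.1, Setoid.ker_def]
  have hcol : ∀ z ∈ B, ∀ w ∈ B, ∀ i, col (M j) (z i) = col (M j) (w i) := by
    intro z hz w hw i
    rw [hB, mem_patternTuples] at hz hw
    rw [hz.2, hw.2]
  have key := sum_card_filter_mul_card (d := d) (M j) (fun r => ∀ i i', r i i' ↔ ρ₂ i i') A B
    (fun z hz => hker z (Finset.mem_filter.1 hz).1) (fun z hz => hcol z (Finset.mem_filter.1 hz).1)
  have hAcard : (A.card : ℝ) ≤ (l : ℝ) ^ w * (m j * l) ^ c₁ := by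
    have := card_filter_map_eq_le (α := HalfEdge l (m j)) ρ₁ (fun h => h.1) l
      (fun a => (card_filter_edge _).le)
    rw [Fintype.card_prod, Fintype.card_fin, Fintype.card_fin] at this
    refine (Nat.cast_le.2 ((Finset.card_le_card ?_).trans this)).trans (le_of_eq (by push_cast; rfl))
    intro z hz
    rw [hA, Finset.mem_filter] at hz
    simp only [Finset.mem_filter, Finset.mem_univ, true_and]
    intro i i' hii
    rwa [← hz.2] at hii
  have hBcard : ∀ G : RegHypergraph d l (m j),
      ((B.filter fun z => ∀ i i', G.vert (z i) = G.vert (z i') ↔ ρ₂ i i').card : ℝ) ≤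
        (d : ℝ) ^ w * (m j * l) ^ c₂ := by
    intro G
    have := card_filter_map_eq_le (α := HalfEdge l (m j)) ρ₂ G.vert d
      (fun a => by rw [filter_vert_eq, card_vert])
    rw [Fintype.card_prod, Fintype.card_fin, Fintype.card_fin] at this
    refine (Nat.cast_le.2 ((Finset.card_le_card ?_).trans this)).trans (le_of_eq (by push_cast; rfl))
    intro z hz
    rw [Finset.mem_filter] at hz
    simp only [Finset.mem_filter, Finset.mem_univ, true_and]
    exact fun i i' hii => (hz.2 i i').2 hii
  have e : ∀ G : RegHypergraph d l (m j), (B.filter fun z => (Setoid.ker fun w => (z w).1) = ρ₁ ∧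
      (Setoid.ker fun w => G.vert (z w)) = ρ₂) =
      A.filter fun z => ∀ i i', G.vert (z i) = G.vert (z i') ↔ ρ₂ i i' := by
    intro G
    rw [hA, Finset.filter_filter]
    refine Finset.filter_congr fun z _ => and_congr_right fun _ => ?_
    rw [Setoid.ext_iff]
    rfl
  have havg : (avg (matchingSet d l (M j)) fun G => ((A.filter fun z =>
      ∀ i i', G.vert (z i) = G.vert (z i') ↔ ρ₂ i i').card : ℝ)) * (B.card : ℝ) =
      (A.card : ℝ) * avg (matchingSet d l (M j)) fun G => ((B.filter fun z =>
      ∀ i i', G.vert (z i) = G.vert (z i') ↔ ρ₂ i i').card : ℝ) := by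
    unfold avg
    rw [div_mul_eq_mul_div, ← mul_div_assoc]
    congr 1
    have key' := congrArg (Nat.cast (R := ℝ)) key
    push_cast at key'
    exact key'
  simp only [e]
  have hB0 : (0 : ℝ) < B.card := hN.trans_le hNB
  rw [eq_div_of_mul_eq hB0.ne' havg]
  have havB : (avg (matchingSet d l (M j)) fun G => ((B.filter fun z =>
      ∀ i i', G.vert (z i) = G.vert (z i') ↔ ρ₂ i i').card : ℝ)) ≤
      (d : ℝ) ^ w * (m j * l) ^ c₂ :=
    le_of_le_of_eq (avg_mono _ fun G _ => hBcard G) (avg_const hS _)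
  calc _ ≤ ((l : ℝ) ^ w * (m j * l) ^ c₁) * ((d : ℝ) ^ w * (m j * l) ^ c₂) / N j := by
        gcongr
        exact avg_nonneg _ fun _ _ => Nat.cast_nonneg _
    _ = _ := by
        simp only [Pi.div_apply, Function.comp]
        change _ = _ / (N j / (m j : ℝ) ^ t)
        rw [mul_pow, mul_pow, pow_add]
        field_simp

end IsAdmissible

section

variable {d l m : ℕ} {I : Type*} [Finite I]

/-- The tuples of closed walks that contain three half-edges of one hyperedge or of one vertex. -/
noncomputable def crowdedWalks (G : RegHypergraph d l m) (s : Equiv.Perm I) :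
    Finset (I ⊕ I → HalfEdge l m) :=
  (Set.toFinite {z | G.IsWalk s z ∧ G.IsCrowded z}).toFinset

theorem mem_crowdedWalks {G : RegHypergraph d l m} {s : Equiv.Perm I}
    {z : I ⊕ I → HalfEdge l m} : z ∈ G.crowdedWalks s ↔ G.IsWalk s z ∧ G.IsCrowded z := by
  simp [crowdedWalks]

end

theorem IsAdmissible.tendsto_avg_crowdedWalks {d l : ℕ} {m : ℕ → ℕ} {M : ∀ j, Finset (Fin (m j))}
    {β : ℝ} (h : IsAdmissible d l m M β) {I : Type*} [Finite I] (s : Equiv.Perm I) :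
    Tendsto (fun j => avg (matchingSet d l (M j)) fun G => ((G.crowdedWalks s).card : ℝ)) atTop
      (𝓝 0) := by
  classical
  have := Fintype.ofFinite I
  have := Fintype.ofFinite (Setoid (I ⊕ I))
  -- Finitely many patterns, independent of `j`: coincidences of half-edges, of hyperedges and of
  -- vertices, and colours.
  let S : Finset (Setoid (I ⊕ I) × Setoid (I ⊕ I) × Setoid (I ⊕ I) × (I ⊕ I → Bool)) :=
    Finset.univ.filter fun p =>
      Nat.card (Quotient p.2.1) + Nat.card (Quotient p.2.2.1) < Nat.card (Quotient p.1)
  have hlim : Tendsto (fun j => ∑ p ∈ S, avg (matchingSet d l (M j)) fun G =>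
      (((patternTuples l (M j) p.1 p.2.2.2).filter fun z =>
        (Setoid.ker fun w => (z w).1) = p.2.1 ∧
        (Setoid.ker fun w => G.vert (z w)) = p.2.2.1).card : ℝ)) atTop (𝓝 (∑ p ∈ S, 0)) :=
    tendsto_finsetSum _ fun p hp => h.tendsto_avg_pattern _ _ _ _ (Finset.mem_filter.1 hp).2
  rw [Finset.sum_const_zero] at hlim
  refine squeeze_zero (fun j => avg_nonneg _ fun _ _ => Nat.cast_nonneg _) (fun j => ?_) hlim
  rw [← avg_sum]
  refine avg_mono _ fun G _ => ?_
  rw [← Nat.cast_sum]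
  refine Nat.cast_le.2 ((Finset.card_le_card ?_).trans Finset.card_biUnion_le)
  intro z hz
  rw [mem_crowdedWalks] at hz
  rw [Finset.mem_biUnion]
  refine ⟨(Setoid.ker z, Setoid.ker fun w => (z w).1, Setoid.ker fun w => G.vert (z w),
    fun i => col (M j) (z i)), ?_, ?_⟩
  · simpa [S] using hz.1.card_lt hz.2
  · rw [Finset.mem_filter, mem_patternTuples]
    exact ⟨⟨rfl, fun _ => rfl⟩, rfl, rfl⟩

end RegHypergraph

/-! ### Sums over colourings as traces. -/

theorem sum_prod_cons_eq_pow_mulVec {α : Type*} [Fintype α] [DecidableEq α] (T : Matrix α α ℝ)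
    (f : α → ℝ) (k : ℕ) (a : α) :
    ∑ τ : Fin k → α, (∏ i : Fin k, T ((Fin.cons a τ : Fin (k + 1) → α) i.castSucc)
      ((Fin.cons a τ : Fin (k + 1) → α) i.succ)) * f ((Fin.cons a τ : Fin (k + 1) → α) (Fin.last k))
        = ((T ^ k).mulVec f) a := by
  induction k generalizing a with
  | zero => simp
  | succ k ih =>
    rw [← (Fin.consEquiv fun _ => α).sum_comp, Fintype.sum_prod_type, pow_succ',
      ← Matrix.mulVec_mulVec]
    simp only [Matrix.mulVec, dotProduct] at ih ⊢
    refine Finset.sum_congr rfl fun x _ => ?_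
    rw [← ih x, Finset.mul_sum]
    refine Finset.sum_congr rfl fun τ _ => ?_
    rw [Fin.prod_univ_succ]
    simp only [Fin.consEquiv_apply, Fin.castSucc_zero, Fin.cons_zero, Fin.cons_succ,
      ← Fin.succ_castSucc, ← Fin.succ_last]
    ring

/-- Sums over closed walks are traces of powers. -/
theorem sum_prod_cyclic_eq_trace {α : Type*} [Fintype α] [DecidableEq α] (T : Matrix α α ℝ)
    (k : ℕ) :
    ∑ τ : Fin (k + 1) → α, ∏ i, T (τ i) (τ (i + 1)) = (T ^ (k + 1)).trace := by
  rw [← (Fin.consEquiv fun _ => α).sum_comp, Fintype.sum_prod_type, Matrix.trace, pow_succ]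
  refine Finset.sum_congr rfl fun a _ => ?_
  -- Cut the closed walk at its start `a`; the column `T b a` is the closing step.
  have := sum_prod_cons_eq_pow_mulVec T (fun b => T b a) k a
  rw [Matrix.diag_apply, Matrix.mul_apply]
  refine Eq.trans (Finset.sum_congr rfl fun τ _ => ?_) this
  rw [Fin.prod_univ_castSucc]
  simp [Fin.consEquiv, Fin.coeSucc_eq_succ]

/-- Sums over colourings of a disjoint union of permutations are products. -/
theorem sum_prod_sigma {J α : Type*} [Fintype J] [DecidableEq J] [Fintype α] (I : J → Type*)
    [∀ j, Fintype (I j)] [∀ j, DecidableEq (I j)] (s : ∀ j, Equiv.Perm (I j)) (T : α → α → ℝ) :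
    ∑ τ : (Σ j, I j) → α, ∏ i, T (τ i) (τ (Equiv.sigmaCongrRight s i)) =
      ∏ j, ∑ τ : I j → α, ∏ i, T (τ i) (τ (s j i)) := by
  rw [Finset.prod_univ_sum, Fintype.piFinset_univ,
    ← (Equiv.piCurry fun (j : J) (_ : I j) => α).sum_comp]
  refine Finset.sum_congr rfl fun τ _ => ?_
  rw [Fintype.prod_sigma]
  rfl

namespace RegHypergraph

/-- The trace is `1 - β/(1-β)` and the determinant `-β/(1-β)`, so the eigenvalues are `1` and
`-β/(1-β)`. Cayley-Hamilton gives a two-step recursion. At `β = 0` the row of `true` is `0/0 = 0`,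
and the formula persists. -/
theorem trace_transition_pow {β : ℝ} (hβ : β < 1) (k : ℕ) :
    (Matrix.trace ((Matrix.of (transition β)) ^ k)) = 1 + (-β / (1 - β)) ^ k := by
  have h1 : 1 - β ≠ 0 := by linarith
  set T : Matrix Bool Bool ℝ := Matrix.of (transition β) with hT
  have hsq : T ^ 2 = (1 - β / (1 - β)) • T + (β / (1 - β)) • (1 : Matrix Bool Bool ℝ) := by
    rcases eq_or_ne β 0 with rfl | h0
    · ext a b
      rw [sq, Matrix.mul_apply]
      cases a <;> cases b <;> simp [hT, transition, pairWeight, colorFreq]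
    · ext a b
      rw [sq, Matrix.mul_apply]
      cases a <;> cases b <;> simp [hT, transition, pairWeight, colorFreq] <;> field_simp <;>
        first | ring1 | simp
  induction k using Nat.twoStepInduction with
  | zero => simp; norm_num
  | one =>
    simp [Matrix.trace, hT, transition, pairWeight, colorFreq]
    field_simp
    ring
  | more k ih₁ ih₂ =>
    rw [pow_add, hsq, mul_add, mul_smul_comm, mul_smul_comm, mul_one, ← pow_succ, Matrix.trace_add,
      Matrix.trace_smul, Matrix.trace_smul, ih₁, ih₂]
    simp only [smul_eq_mul, pow_succ]
    field_simp
    ring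

/-- The rotation of `ZMod k`. -/
def shift (k : ℕ) : Equiv.Perm (ZMod k) := Equiv.addRight 1

theorem shift_apply (k : ℕ) (i : ZMod k) : shift k i = i + 1 := rfl

theorem sum_prod_shift {β : ℝ} (hβ : β < 1) (k : ℕ) :
    ∑ τ : ZMod (k + 1) → Bool, ∏ i, transition β (τ i) (τ (shift (k + 1) i)) =
      1 + (-β / (1 - β)) ^ (k + 1) := by
  rw [← trace_transition_pow hβ]
  exact sum_prod_cyclic_eq_trace (Matrix.of (transition β)) k

end RegHypergraph

/-! ### Circuits versus cycles. -/

namespace RegHypergraph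

variable {d l m : ℕ} {G : RegHypergraph d l m}

theorem isCrowded_of_subset {W W' : Type*} {z : W → HalfEdge l m} {z' : W' → HalfEdge l m}
    (hz : G.IsCrowded z) (h : Set.range z ⊆ Set.range z') : G.IsCrowded z' := by
  obtain ⟨i, j, k, h₁, h₂, h₃, h₄⟩ := hz
  obtain ⟨i', hi⟩ := h ⟨i, rfl⟩
  obtain ⟨j', hj⟩ := h ⟨j, rfl⟩
  obtain ⟨k', hk⟩ := h ⟨k, rfl⟩
  exact ⟨i', j', k', by rw [hi, hj]; exact h₁, by rw [hj, hk]; exact h₂, by rw [hi, hk]; exact h₃,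
    by rw [hi, hj, hk]; exact h₄⟩

/-- The circuits of length `k`. -/
def Circuit (G : RegHypergraph d l m) (k : ℕ) : Type :=
  {z : ZMod k ⊕ ZMod k → HalfEdge l m // G.IsCircuit (shift k) z}

namespace Circuit

variable {k : ℕ}

theorem edge_eq (z : G.Circuit k) (i : ZMod k) : (z.1 (.inl i)).1 = (z.1 (.inr i)).1 :=
  (z.2.1 i).1.1

theorem edge_ne (z : G.Circuit k) (i : ZMod k) : z.1 (.inl i) ≠ z.1 (.inr i) :=
  (z.2.1 i).1.2

theorem vert_eq (z : G.Circuit k) (i : ZMod k) :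
    G.vert (z.1 (.inr i)) = G.vert (z.1 (.inl (i + 1))) :=
  (z.2.1 i).2.1

theorem vert_ne (z : G.Circuit k) (i : ZMod k) : z.1 (.inr i) ≠ z.1 (.inl (i + 1)) :=
  (z.2.1 i).2.2

theorem inl_eq_inl (z : G.Circuit k) {i j : ZMod k} (h : (z.1 (.inl i)).1 = (z.1 (.inl j)).1) :
    i = j :=
  z.2.2.1 h

theorem inl_injective (z : G.Circuit k) : Function.Injective fun i => z.1 (.inl i) :=
  fun _ _ h => z.inl_eq_inl (congrArg Prod.fst h)

theorem inr_injective (z : G.Circuit k) : Function.Injective fun i => z.1 (.inr i) :=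
  fun i j h => z.inl_eq_inl ((z.edge_eq i).trans ((congrArg Prod.fst h).trans (z.edge_eq j).symm))

theorem inl_ne_inr (z : G.Circuit k) (i j : ZMod k) : z.1 (.inl i) ≠ z.1 (.inr j) := by
  intro h
  have := z.inl_eq_inl ((congrArg Prod.fst h).trans (z.edge_eq j).symm)
  subst this
  exact z.edge_ne i h

/-- The sequence of vertices and hyperedges of a circuit. -/
def toSeq (z : G.Circuit k) : G.CycleSeq k where
  v i := G.vert (z.1 (.inl i))
  e i := (z.1 (.inl i)).1
  v_mem i := G.vert_mem _
  v_injective := z.2.2.2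
  e_injective := z.2.2.1
  incident i := ⟨z.1 (.inl i), G.mem_vert _, z.1 (.inr i), by rw [← z.vert_eq]; exact G.mem_vert _,
    z.edge_ne i, rfl, (z.edge_eq i).symm⟩

theorem toSeq_surjective : Function.Surjective (toSeq : G.Circuit k → G.CycleSeq k) := by
  intro c
  choose x hx y hy hxy hxe hye using c.incident
  have hv : ∀ i, G.vert (x i) = c.v i := fun i => G.vert_eq_of_mem (c.v_mem i) (hx i)
  have hv' : ∀ i, G.vert (y i) = c.v (i + 1) := fun i => G.vert_eq_of_mem (c.v_mem _) (hy i)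
  refine ⟨⟨Sum.elim x y, fun i => ⟨⟨(hxe i).trans (hye i).symm, hxy i⟩,
    (hv' i).trans (hv (i + 1)).symm, fun h => ?_⟩, ?_, ?_⟩, ?_⟩
  · have h' : y i = x (i + 1) := h
    -- Only `k = 1` allows this, and there it contradicts that the two half-edges of a hyperedge
    -- differ.
    have : i = i + 1 := c.e_injective (by rw [← hye, ← hxe, h'])
    rw [← this] at h'
    exact hxy i h'.symm
  · intro i j h
    exact c.e_injective (by rw [← hxe, ← hxe]; exact h)
  · intro i j h
    exact c.v_injective (by rw [← hv, ← hv]; exact h)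
  · cases c
    simp only [toSeq, Sum.elim_inl] at hv hxe ⊢
    congr 1
    · exact funext hv
    · exact funext hxe

/-- The cycle of a circuit. -/
def toCycle (z : G.Circuit k) : G.Cycle k := Quot.mk _ z.toSeq

theorem toCycle_surjective : Function.Surjective (toCycle : G.Circuit k → G.Cycle k) :=
  Quot.mk_surjective.comp toSeq_surjective

/-- Rotation of a circuit. -/
def rot (n : ZMod k) (z : G.Circuit k) : G.Circuit k :=
  ⟨Sum.elim (fun i => z.1 (.inl (i + n))) (fun i => z.1 (.inr (i + n))), fun i =>
    ⟨⟨z.edge_eq _, z.edge_ne _⟩, by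
      simp only [Sum.elim_inl, Sum.elim_inr, shift_apply, add_right_comm i 1 n]
      exact ⟨z.vert_eq _, z.vert_ne _⟩⟩,
    fun _ _ h => add_right_cancel (z.2.2.1 h), fun _ _ h => add_right_cancel (z.2.2.2 h)⟩

/-- Reflection of a circuit. -/
def refl (n : ZMod k) (z : G.Circuit k) : G.Circuit k :=
  ⟨Sum.elim (fun i => z.1 (.inr (n - i))) (fun i => z.1 (.inl (n - i))), fun i =>
    ⟨⟨(z.edge_eq _).symm, (z.edge_ne _).symm⟩, by
      have h := And.intro (z.vert_eq (n - (i + 1))) (z.vert_ne (n - (i + 1)))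
      rw [show n - (i + 1) + 1 = n - i by ring] at h
      exact ⟨h.1.symm, h.2.symm⟩⟩,
    fun i j h => by
      have h' : (z.1 (.inr (n - i))).1 = (z.1 (.inr (n - j))).1 := h
      rw [← z.edge_eq, ← z.edge_eq] at h'
      exact sub_right_injective (z.inl_eq_inl h'),
    fun i j h => by
      have h' : G.vert (z.1 (.inr (n - i))) = G.vert (z.1 (.inr (n - j))) := h
      rw [z.vert_eq, z.vert_eq] at h'
      exact sub_right_injective (add_right_cancel (z.2.2.2 h'))⟩

theorem toCycle_rot_one (z : G.Circuit k) : (rot 1 z).toCycle = z.toCycle :=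
  (Quot.sound (r := CycleSeq.Step) (a := z.toSeq) (b := (rot 1 z).toSeq)
    (Or.inl fun _ => ⟨rfl, rfl⟩)).symm

theorem toCycle_rot [NeZero k] (n : ZMod k) (z : G.Circuit k) : (rot n z).toCycle = z.toCycle := by
  have key : ∀ n : ℕ, (rot (n : ZMod k) z).toCycle = z.toCycle := by
    intro n
    induction n with
    | zero =>
      congr 1
      apply Subtype.ext
      ext (i | i) <;> simp [rot]
    | succ n ih =>
      rw [← ih, ← toCycle_rot_one (rot (n : ZMod k) z)]
      congr 1
      apply Subtype.ext
      funext w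
      rcases w with i | i <;> simp only [rot, Sum.elim_inl, Sum.elim_inr] <;>
        rw [Nat.cast_succ, add_right_comm, add_assoc]
  have := key n.val
  rwa [ZMod.natCast_zmod_val] at this

theorem toCycle_refl [NeZero k] (n : ZMod k) (z : G.Circuit k) :
    (refl n z).toCycle = z.toCycle := by
  -- `CycleSeq.Step` provides only the reversal that fixes vertex `0`; on hyperedges it is `i ↦ -i -
  -- 1`, that is `refl (-1)`.
  have h₁ : refl n z = refl (-1) (rot (n + 1) z) := by
    apply Subtype.ext
    funext w
    rcases w with i | i <;> simp only [refl, rot, Sum.elim_inl, Sum.elim_inr] <;>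
      rw [show -1 - i + (n + 1) = n - i by ring]
  have h₂ : ∀ y : G.Circuit k, (refl (-1) y).toCycle = y.toCycle := by
    intro y
    refine (Quot.sound (r := CycleSeq.Step) (a := y.toSeq) (b := (refl (-1) y).toSeq)
      (Or.inr fun i => ⟨?_, ?_⟩)).symm
    · have := y.vert_eq (-1 - i)
      rw [show -1 - i + 1 = -i by ring] at this
      exact this
    · have := y.edge_eq (-1 - i)
      rw [show -1 - i = -i - 1 by ring] at this
      simp only [toSeq, refl, Sum.elim_inl]
      rw [show -1 - i = -i - 1 by ring]
      exact this.symm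
  rw [h₁, h₂, toCycle_rot]

theorem exists_edge_eq_of_toCycle_eq {z z' : G.Circuit k} (h : z.toCycle = z'.toCycle)
    (i : ZMod k) : ∃ j, (z.1 (.inl i)).1 = (z'.1 (.inl j)).1 := by
  let f : G.Cycle k → Set (Fin m) := Quot.lift (fun c => Set.range c.e) (by
    rintro c c' (h | h)
    · ext x
      constructor
      · rintro ⟨i, rfl⟩
        exact ⟨i - 1, by rw [(h _).2, sub_add_cancel]⟩
      · rintro ⟨i, rfl⟩
        exact ⟨i + 1, (h i).2.symm⟩
    · ext x
      constructor
      · rintro ⟨i, rfl⟩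
        exact ⟨-i - 1, by rw [(h _).2]; congr 1; ring⟩
      · rintro ⟨i, rfl⟩
        exact ⟨-i - 1, (h i).2.symm⟩)
  have : Set.range z.toSeq.e = Set.range z'.toSeq.e := congrArg f h
  obtain ⟨j, hj⟩ := this ▸ Set.mem_range_self (f := z.toSeq.e) i
  exact ⟨j, hj.symm⟩

/-- The half-edges of two circuits. -/
abbrev pair {k' : ℕ} (z : G.Circuit k) (z' : G.Circuit k') :
    (ZMod k ⊕ ZMod k) ⊕ (ZMod k' ⊕ ZMod k') → HalfEdge l m :=
  Sum.elim z.1 z'.1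

section uncrowded

variable {k' : ℕ} {z : G.Circuit k} {z' : G.Circuit k'}

theorem eq_of_edge_eq (hc : ¬ G.IsCrowded (pair z z')) {i j n} (hij : pair z z' i ≠ pair z z' j)
    (hin : pair z z' i ≠ pair z z' n) (h₁ : (pair z z' i).1 = (pair z z' j).1)
    (h₂ : (pair z z' i).1 = (pair z z' n).1) : pair z z' j = pair z z' n := by
  by_contra h
  exact hc ⟨i, j, n, hij, h, hin, Or.inl ⟨h₁, h₁.symm.trans h₂⟩⟩

theorem eq_of_vert_eq (hc : ¬ G.IsCrowded (pair z z')) {i j n} (hij : pair z z' i ≠ pair z z' j)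
    (hin : pair z z' i ≠ pair z z' n) (h₁ : G.vert (pair z z' i) = G.vert (pair z z' j))
    (h₂ : G.vert (pair z z' i) = G.vert (pair z z' n)) : pair z z' j = pair z z' n := by
  by_contra h
  exact hc ⟨i, j, n, hij, h, hin, Or.inr ⟨h₁, h₁.symm.trans h₂⟩⟩

theorem inr_eq_of_inl_eq (hc : ¬ G.IsCrowded (pair z z')) {i j} (h : z'.1 (.inl j) = z.1 (.inl i)) :
    z'.1 (.inr j) = z.1 (.inr i) :=
  eq_of_edge_eq hc (i := .inl (.inl i)) (j := .inr (.inr j)) (n := .inl (.inr i))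
    (by simp only [pair, Sum.elim_inl, Sum.elim_inr]; rw [← h]; exact z'.edge_ne j) (z.edge_ne i)
    (by simp only [pair, Sum.elim_inl, Sum.elim_inr]; rw [← h]; exact z'.edge_eq j) (z.edge_eq i)

theorem inl_succ_eq_of_inr_eq (hc : ¬ G.IsCrowded (pair z z')) {i j}
    (h : z'.1 (.inr j) = z.1 (.inr i)) : z'.1 (.inl (j + 1)) = z.1 (.inl (i + 1)) :=
  eq_of_vert_eq hc (i := .inl (.inr i)) (j := .inr (.inl (j + 1))) (n := .inl (.inl (i + 1)))
    (by simp only [pair, Sum.elim_inl, Sum.elim_inr]; rw [← h]; exact z'.vert_ne j) (z.vert_ne i)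
    (by simp only [pair, Sum.elim_inl, Sum.elim_inr]; rw [← h]; exact z'.vert_eq j) (z.vert_eq i)

theorem inr_eq_of_inl_eq_inr (hc : ¬ G.IsCrowded (pair z z')) {i j}
    (h : z'.1 (.inl j) = z.1 (.inr i)) : z'.1 (.inr j) = z.1 (.inl i) :=
  eq_of_edge_eq hc (i := .inl (.inr i)) (j := .inr (.inr j)) (n := .inl (.inl i))
    (by simp only [pair, Sum.elim_inl, Sum.elim_inr]; rw [← h]; exact z'.edge_ne j)
    (z.edge_ne i).symm
    (by simp only [pair, Sum.elim_inl, Sum.elim_inr]; rw [← h]; exact z'.edge_eq j)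
    (z.edge_eq i).symm

theorem inl_succ_eq_of_inr_eq_inl (hc : ¬ G.IsCrowded (pair z z')) {i j}
    (h : z'.1 (.inr j) = z.1 (.inl (i + 1))) : z'.1 (.inl (j + 1)) = z.1 (.inr i) :=
  eq_of_vert_eq hc (i := .inl (.inl (i + 1))) (j := .inr (.inl (j + 1))) (n := .inl (.inr i))
    (by simp only [pair, Sum.elim_inl, Sum.elim_inr]; rw [← h]; exact z'.vert_ne j)
    (z.vert_ne i).symm
    (by simp only [pair, Sum.elim_inl, Sum.elim_inr]; rw [← h]; exact z'.vert_eq j)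
    (z.vert_eq i).symm

/-- Without crowding, a hyperedge or vertex holds at most two half-edges of the pair, so the
continuation is forced: circuits that meet stay together. -/
theorem parallel (hc : ¬ G.IsCrowded (pair z z')) {i j} (h : z'.1 (.inl j) = z.1 (.inl i)) (n : ℕ) :
    z'.1 (.inl (j + n)) = z.1 (.inl (i + n)) ∧ z'.1 (.inr (j + n)) = z.1 (.inr (i + n)) := by
  induction n with
  | zero =>
    rw [Nat.cast_zero, Nat.cast_zero, add_zero, add_zero]
    exact ⟨h, inr_eq_of_inl_eq hc h⟩
  | succ n ih =>
    have := inl_succ_eq_of_inr_eq hc ih.2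
    rw [Nat.cast_succ, Nat.cast_succ, ← add_assoc, ← add_assoc]
    exact ⟨this, inr_eq_of_inl_eq hc this⟩

theorem antiparallel (hc : ¬ G.IsCrowded (pair z z')) {i j} (h : z'.1 (.inl j) = z.1 (.inr i))
    (n : ℕ) :
    z'.1 (.inl (j + n)) = z.1 (.inr (i - n)) ∧ z'.1 (.inr (j + n)) = z.1 (.inl (i - n)) := by
  induction n with
  | zero =>
    rw [Nat.cast_zero, Nat.cast_zero, add_zero, sub_zero]
    exact ⟨h, inr_eq_of_inl_eq_inr hc h⟩
  | succ n ih =>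
    have ih' := ih.2
    rw [show i - (n : ZMod k) = i - (n + 1) + 1 by ring] at ih'
    have := inl_succ_eq_of_inr_eq_inl hc ih'
    rw [Nat.cast_succ, Nat.cast_succ, ← add_assoc]
    exact ⟨this, inr_eq_of_inl_eq_inr hc this⟩

/-- Two uncrowded circuits that share a hyperedge or a vertex share a half-edge. -/
theorem exists_eq_of_share (hc : ¬ G.IsCrowded (pair z z'))
    (h : ∃ i j, (z.1 (.inl i)).1 = (z'.1 (.inl j)).1 ∨
      G.vert (z.1 (.inl i)) = G.vert (z'.1 (.inl j))) :
    ∃ i j, z'.1 (.inl j) = z.1 (.inl i) ∨ z'.1 (.inl j) = z.1 (.inr i) := by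
  obtain ⟨i, j, h | h⟩ := h
  · refine ⟨i, j, ?_⟩
    by_contra hne
    push Not at hne
    exact hne.2 (eq_of_edge_eq hc (i := .inl (.inl i)) (j := .inr (.inl j)) (n := .inl (.inr i))
      hne.1.symm (z.edge_ne i) h (z.edge_eq i))
  · by_contra hne
    push Not at hne
    have h₁ := z.vert_ne (i - 1)
    have h₂ := z.vert_eq (i - 1)
    rw [sub_add_cancel] at h₁ h₂
    exact (hne (i - 1) j).2 (eq_of_vert_eq hc (i := .inl (.inl i)) (j := .inr (.inl j))
      (n := .inl (.inr (i - 1))) (hne i j).1.symm h₁.symm h h₂.symm)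

/-- When one circuit closes up, the other is back at its starting half-edge, so each length divides
the other. -/
theorem length_eq (hc : ¬ G.IsCrowded (pair z z'))
    (h : ∃ i j, z'.1 (.inl j) = z.1 (.inl i) ∨ z'.1 (.inl j) = z.1 (.inr i)) : k' = k := by
  obtain ⟨i, j, h | h⟩ := h
  · apply Nat.dvd_antisymm
    · have := (parallel hc h k).1
      rw [ZMod.natCast_self, add_zero, ← h] at this
      rw [← ZMod.natCast_eq_zero_iff]
      exact left_eq_add.1 (z'.inl_injective this).symm
    · have := (parallel hc h k').1
      rw [ZMod.natCast_self, add_zero, h] at this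
      rw [← ZMod.natCast_eq_zero_iff]
      exact left_eq_add.1 (z.inl_injective this)
  · apply Nat.dvd_antisymm
    · have := (antiparallel hc h k).1
      rw [ZMod.natCast_self, sub_zero, ← h] at this
      rw [← ZMod.natCast_eq_zero_iff]
      exact left_eq_add.1 (z'.inl_injective this).symm
    · have := (antiparallel hc h k').1
      rw [ZMod.natCast_self, add_zero, h] at this
      rw [← ZMod.natCast_eq_zero_iff]
      exact sub_eq_self.1 (z.inr_injective this).symm

end uncrowded

theorem exists_rot_or_refl [NeZero k] {z z' : G.Circuit k} (hc : ¬ G.IsCrowded (pair z z'))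
    (h : ∃ i j, z'.1 (.inl j) = z.1 (.inl i) ∨ z'.1 (.inl j) = z.1 (.inr i)) :
    ∃ n, z' = rot n z ∨ z' = refl n z := by
  obtain ⟨i, j, h | h⟩ := h
  · refine ⟨i - j, Or.inl (Subtype.ext (funext fun w => ?_))⟩
    have key : ∀ a, z'.1 (.inl a) = z.1 (.inl (a + (i - j))) ∧
        z'.1 (.inr a) = z.1 (.inr (a + (i - j))) := by
      intro a
      have := parallel hc h (a - j).val
      rw [ZMod.natCast_zmod_val, add_sub_cancel, show i + (a - j) = a + (i - j) by ring] at this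
      exact this
    rcases w with a | a
    · exact (key a).1
    · exact (key a).2
  · refine ⟨i + j, Or.inr (Subtype.ext (funext fun w => ?_))⟩
    have key : ∀ a, z'.1 (.inl a) = z.1 (.inr (i + j - a)) ∧
        z'.1 (.inr a) = z.1 (.inl (i + j - a)) := by
      intro a
      have := antiparallel hc h (a - j).val
      rw [ZMod.natCast_zmod_val, add_sub_cancel, show i - (a - j) = i + j - a by ring] at this
      exact this
    rcases w with a | a
    · exact (key a).1
    · exact (key a).2

/-- At `inl 0` rotations take `inl` values and reflections `inr` values, and all these half-edges
differ. Hence there are exactly `2k` circuits even for `k = 1, 2`, where vertices and hyperedges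
alone would not distinguish them. -/
theorem rot_or_refl_injective (z : G.Circuit k) :
    Function.Injective fun p : ZMod k × Bool => if p.2 then rot p.1 z else refl p.1 z := by
  rintro ⟨n, a⟩ ⟨n', a'⟩ h
  have h' := congrFun (congrArg Subtype.val h) (.inl 0)
  rcases a <;> rcases a'
  · have := z.inr_injective (h' : z.1 (.inr (n - 0)) = z.1 (.inr (n' - 0)))
    rw [sub_zero, sub_zero] at this
    exact Prod.ext this rfl
  · exact absurd h'.symm (z.inl_ne_inr (0 + n') (n - 0))
  · exact absurd h' (z.inl_ne_inr (0 + n) (n' - 0))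
  · have := z.inl_injective (h' : z.1 (.inl (0 + n)) = z.1 (.inl (0 + n')))
    rw [zero_add, zero_add] at this
    exact Prod.ext this rfl

instance : Finite (G.Circuit k) := by
  rcases Nat.eq_zero_or_pos k with rfl | hk
  · exact Finite.of_injective (fun z : G.Circuit 0 => z.1 (.inl 0)) (by
      intro z
      -- For `k = 0` there are no circuits, as infinitely many distinct half-edges would be needed.
      have : Infinite (ZMod 0) := inferInstanceAs (Infinite ℤ)
      exact absurd (Finite.of_injective _ z.inl_injective) (not_finite_iff_infinite.2 this))
  · have : NeZero k := ⟨hk.ne'⟩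
    unfold Circuit
    infer_instance

end Circuit

instance {k : ℕ} : Finite (G.Cycle k) := Finite.of_surjective _ Circuit.toCycle_surjective

/-! ### Good hypergraphs and families of disjoint circuits. -/

/-- Any two circuits of lengths at most `b` are uncrowded. -/
def IsGood (G : RegHypergraph d l m) (b : ℕ) : Prop :=
  ∀ k k' : Fin b, ∀ (z : G.Circuit (k + 1)) (z' : G.Circuit (k' + 1)),
    ¬ G.IsCrowded (Circuit.pair z z')

namespace IsGood

variable {b : ℕ}

theorem toCycle_eq_iff (hG : G.IsGood b) (k : Fin b) (z z' : G.Circuit (k + 1)) :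
    z.toCycle = z'.toCycle ↔ ∃ n, z' = z.rot n ∨ z' = z.refl n := by
  constructor
  · intro h
    obtain ⟨j, hj⟩ := Circuit.exists_edge_eq_of_toCycle_eq h 0
    exact Circuit.exists_rot_or_refl (hG k k z z')
      (Circuit.exists_eq_of_share (hG k k z z') ⟨0, j, Or.inl hj⟩)
  · rintro ⟨n, rfl | rfl⟩
    · rw [Circuit.toCycle_rot]
    · rw [Circuit.toCycle_refl]

/-- Each cycle arises from `2 k` circuits. -/
theorem exists_equiv (hG : G.IsGood b) (k : Fin b) :
    ∃ E : G.Circuit (k + 1) ≃ G.Cycle (k + 1) × (ZMod (k + 1) × Bool),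
      ∀ z, (E z).1 = z.toCycle := by
  choose z₀ hz₀ using Circuit.toCycle_surjective (G := G) (k := k + 1)
  let F : G.Cycle (k + 1) × (ZMod (k + 1) × Bool) → G.Circuit (k + 1) := fun p =>
    if p.2.2 then (z₀ p.1).rot p.2.1 else (z₀ p.1).refl p.2.1
  have hF : ∀ p, (F p).toCycle = p.1 := by
    rintro ⟨q, n, a⟩
    cases a
    · simp only [F, Bool.false_eq_true, if_false]
      rw [Circuit.toCycle_refl, hz₀]
    · simp only [F, if_true]
      rw [Circuit.toCycle_rot, hz₀]
  have hbij : Function.Bijective F := by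
    constructor
    · rintro ⟨q, p⟩ ⟨q', p'⟩ h
      have hq : q = q' := by
        have := congrArg Circuit.toCycle h
        rwa [hF, hF] at this
      subst hq
      exact congrArg (Prod.mk q) ((z₀ q).rot_or_refl_injective h)
    · intro z
      obtain ⟨n, h | h⟩ := (hG.toCycle_eq_iff k (z₀ z.toCycle) z).1 (hz₀ _)
      · exact ⟨(z.toCycle, n, true), by simp only [F, if_true]; exact h.symm⟩
      · exact ⟨(z.toCycle, n, false), by simp only [F, Bool.false_eq_true, if_false]; exact h.symm⟩
  refine ⟨(Equiv.ofBijective F hbij).symm, fun z => ?_⟩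
  rw [← hF, ← Equiv.ofBijective_apply F hbij, Equiv.apply_symm_apply]

end IsGood

end RegHypergraph

namespace RegHypergraph

variable {d l m : ℕ} {G : RegHypergraph d l m}

/-- The circuits `z` and `z'` have no hyperedge and no vertex in common. -/
def Circuit.IsDisjoint {k k' : ℕ} (z : G.Circuit k) (z' : G.Circuit k') : Prop :=
  ∀ i i', (z.1 (.inl i)).1 ≠ (z'.1 (.inl i')).1 ∧ G.vert (z.1 (.inl i)) ≠ G.vert (z'.1 (.inl i'))

/-- The disjoint union of rotations of `ZMod (len j)`. -/
def familyShift {J : Type*} (len : J → ℕ) : Equiv.Perm (Σ j, ZMod (len j)) :=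
  Equiv.sigmaCongrRight fun j => shift (len j)

/-- Circuits along a disjoint union of rotations are families of disjoint circuits. -/
def familyEquiv {J : Type*} (len : J → ℕ) :
    {z : (Σ j, ZMod (len j)) ⊕ (Σ j, ZMod (len j)) → HalfEdge l m //
      G.IsCircuit (familyShift len) z} ≃
    {c : ∀ j, G.Circuit (len j) // ∀ j j', j ≠ j' → (c j).IsDisjoint (c j')} where
  toFun z := ⟨fun j => ⟨Sum.elim (fun i => z.1 (.inl ⟨j, i⟩)) (fun i => z.1 (.inr ⟨j, i⟩)),
    fun i => z.2.1 ⟨j, i⟩, fun i i' h => eq_of_heq (Sigma.mk.inj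
      (show (⟨j, i⟩ : Σ j, ZMod (len j)) = ⟨j, i'⟩ from z.2.2.1 h)).2,
      fun i i' h => eq_of_heq (Sigma.mk.inj
      (show (⟨j, i⟩ : Σ j, ZMod (len j)) = ⟨j, i'⟩ from z.2.2.2 h)).2⟩, fun j j' hj i i' =>
        ⟨fun h => hj (congrArg Sigma.fst
          (show (⟨j, i⟩ : Σ j, ZMod (len j)) = ⟨j', i'⟩ from z.2.2.1 h)),
          fun h => hj (congrArg Sigma.fst
          (show (⟨j, i⟩ : Σ j, ZMod (len j)) = ⟨j', i'⟩ from z.2.2.2 h))⟩⟩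
  invFun c := ⟨Sum.elim (fun p => (c.1 p.1).1 (.inl p.2)) (fun p => (c.1 p.1).1 (.inr p.2)),
    fun p => (c.1 p.1).2.1 p.2, by
      rintro ⟨j, i⟩ ⟨j', i'⟩ h
      by_cases hj : j = j'
      · subst hj
        exact congrArg (Sigma.mk j) ((c.1 j).2.2.1 h)
      · exact absurd h (c.2 j j' hj i i').1, by
      rintro ⟨j, i⟩ ⟨j', i'⟩ h
      by_cases hj : j = j'
      · subst hj
        exact congrArg (Sigma.mk j) ((c.1 j).2.2.2 h)
      · exact absurd h (c.2 j j' hj i i').2⟩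
  left_inv z := by
    apply Subtype.ext
    funext w
    rcases w with w | w <;> rfl
  right_inv c := by
    apply Subtype.ext
    funext j
    apply Subtype.ext
    funext w
    rcases w with w | w <;> rfl

/-- Families of elements of `X` with distinct images in `Y`, if `X` is a product `Y × B`. -/
def injectiveCompEquiv {A X Y B : Type*} (E : X ≃ Y × B) :
    {f : A → X // Function.Injective fun a => (E (f a)).1} ≃ (A ↪ Y) × (A → B) where
  toFun f := (⟨fun a => (E (f.1 a)).1, f.2⟩, fun a => (E (f.1 a)).2)
  invFun p := ⟨fun a => E.symm (p.1 a, p.2 a), by simpa using p.1.injective⟩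
  left_inv f := by
    apply Subtype.ext
    funext a
    simp
  right_inv p := by
    ext a <;> simp

/-- In a good hypergraph circuits that share a hyperedge or vertex have equal length and differ by a
rotation or reflection; disjointness is thus distinctness of cycles. -/
theorem IsGood.isDisjoint_iff {b : ℕ} (hG : G.IsGood b) {k k' : Fin b} (z : G.Circuit (k + 1))
    (z' : G.Circuit (k' + 1)) :
    z.IsDisjoint z' ↔ ∀ h : k' = k, z.toCycle ≠ Circuit.toCycle (h ▸ z' : G.Circuit (k + 1)) := by
  constructor
  · rintro hd rfl h
    obtain ⟨j, hj⟩ := Circuit.exists_edge_eq_of_toCycle_eq h 0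
    exact (hd 0 j).1 hj
  · intro h i i'
    by_contra hne
    have hs : ∃ i j, (z.1 (.inl i)).1 = (z'.1 (.inl j)).1 ∨
        G.vert (z.1 (.inl i)) = G.vert (z'.1 (.inl j)) := ⟨i, i', by tauto⟩
    have hs := Circuit.exists_eq_of_share (hG k k' z z') hs
    have hk := Circuit.length_eq (hG k k' z z') hs
    have hk' : k' = k := Fin.ext (by omega)
    subst hk'
    exact h rfl ((hG.toCycle_eq_iff _ _ _).2 (Circuit.exists_rot_or_refl (hG _ _ z z') hs))

/-- The lengths of the circuits in a family with `r k` circuits of length `k + 1`. -/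
abbrev familyLength {b : ℕ} (r : Fin b → ℕ) (j : Σ k : Fin b, Fin (r k)) : ℕ := j.1 + 1

theorem natCard_embedding (A B : Type*) [Finite A] [Finite B] :
    Nat.card (A ↪ B) = (Nat.card B).descFactorial (Nat.card A) := by
  classical
  have := Fintype.ofFinite A
  have := Fintype.ofFinite B
  rw [Nat.card_eq_fintype_card, Nat.card_eq_fintype_card, Nat.card_eq_fintype_card,
    Fintype.card_embedding_eq]

/-- Lengths decouple, since different lengths are automatically disjoint. For each length choose
distinct cycles, giving a falling factorial, and one of the `2(k+1)` circuits of each. -/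
theorem IsGood.card_circuits_family {b : ℕ} (hG : G.IsGood b) (r : Fin b → ℕ) :
    (G.circuits (familyShift (familyLength r))).card =
      ∏ k : Fin b, ((G.cycleCount (k + 1)).descFactorial (r k) * (2 * (k + 1)) ^ r k) := by
  choose E hE using hG.exists_equiv
  have e₁ : (G.circuits (familyShift (familyLength r))).card =
      Nat.card {z // G.IsCircuit (familyShift (familyLength r)) z} := by
    rw [Nat.subtype_card _ fun z => mem_circuits]
  have e₂ : {c : ∀ j, G.Circuit (familyLength r j) // ∀ j j', j ≠ j' → (c j).IsDisjoint (c j')} ≃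
      {c : ∀ k : Fin b, Fin (r k) → G.Circuit (k + 1) //
        ∀ k, Function.Injective fun a => (E k (c k a)).1} :=
    (Equiv.piCurry fun (k : Fin b) (_ : Fin (r k)) => G.Circuit (k + 1)).subtypeEquiv fun c => by
      simp only [hE]
      constructor
      · intro h k a a' haa
        by_contra hne
        exact (hG.isDisjoint_iff _ _).1 (h ⟨k, a⟩ ⟨k, a'⟩ (by simpa using hne)) rfl haa
      · rintro h ⟨k, a⟩ ⟨k', a'⟩ hne
        refine (hG.isDisjoint_iff _ _).2 fun hk => ?_
        change k' = k at hk
        subst hk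
        exact fun haa => hne (by rw [h k' haa])
  have e₃ := Nat.card_congr (((familyEquiv (G := G) (familyLength r)).trans e₂).trans
    ((Equiv.subtypePiEquivPi (p := fun (k : Fin b) (f : Fin (r k) → G.Circuit (k + 1)) =>
      Function.Injective fun a => (E k (f a)).1)).trans
        (Equiv.piCongrRight fun k => injectiveCompEquiv (E k))))
  rw [e₁, e₃, Nat.card_pi]
  refine Finset.prod_congr rfl fun k _ => ?_
  rw [Nat.card_prod, natCard_embedding, Nat.card_fun, Nat.card_prod]
  simp only [Nat.card_eq_fintype_card, Fintype.card_fin, ZMod.card, Fintype.card_bool, cycleCount]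
  ring

theorem natCard_circuit (k : ℕ) [NeZero k] : Nat.card (G.Circuit k) = (G.circuits (shift k)).card :=
  Nat.subtype_card _ fun _ => mem_circuits

theorem cycleCount_le (k : ℕ) [NeZero k] : G.cycleCount k ≤ (G.circuits (shift k)).card := by
  rw [← natCard_circuit]
  exact Nat.card_le_card_of_surjective _ Circuit.toCycle_surjective

theorem IsGood.card_circuits_shift {b : ℕ} (hG : G.IsGood b) (k : Fin b) :
    (G.circuits (shift (k + 1))).card = G.cycleCount (k + 1) * (2 * (k + 1)) := by
  obtain ⟨E, -⟩ := hG.exists_equiv k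
  rw [← natCard_circuit, Nat.card_congr E, Nat.card_prod, Nat.card_prod, cycleCount]
  simp only [Nat.card_eq_fintype_card, ZMod.card, Fintype.card_bool]
  ring

/-! ### Discarding bad hypergraphs and passing to the limit. -/

/-- A pair of tuples of half-edges as a tuple on the disjoint union. -/
def merge {α I I' : Type*} (z : I ⊕ I → α) (z' : I' ⊕ I' → α) : (I ⊕ I') ⊕ (I ⊕ I') → α :=
  Sum.elim (Sum.elim (fun i => z (.inl i)) (fun i => z' (.inl i)))
    (Sum.elim (fun i => z (.inr i)) (fun i => z' (.inr i)))

theorem IsWalk.merge {I I' : Type*} {s : Equiv.Perm I} {s' : Equiv.Perm I'}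
    {z : I ⊕ I → HalfEdge l m} {z' : I' ⊕ I' → HalfEdge l m} (hz : G.IsWalk s z)
    (hz' : G.IsWalk s' z') : G.IsWalk (Equiv.sumCongr s s') (merge z z') := by
  rintro (i | i)
  · exact hz i
  · exact hz' i

/-- The successor function for pairs of circuits of lengths `k + 1` and `k' + 1` besides `s`. -/
def extendShift {I : Type*} (s : Equiv.Perm I) (k k' : ℕ) :
    Equiv.Perm (I ⊕ (ZMod (k + 1) ⊕ ZMod (k' + 1))) :=
  Equiv.sumCongr s (Equiv.sumCongr (shift (k + 1)) (shift (k' + 1)))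

/-- A bound for the number of circuits of a hypergraph that is not good. -/
noncomputable def badCount {I : Type*} [Finite I] (G : RegHypergraph d l m) (b : ℕ)
    (s : Equiv.Perm I) : ℕ :=
  ∑ k : Fin b, ∑ k' : Fin b, (G.crowdedWalks (extendShift s k k')).card

/-- Fix one crowded pair of short circuits and append it to every circuit: this is an injection into
crowded walks. -/
theorem card_circuits_le_badCount {I : Type*} [Finite I] {b : ℕ} (hG : ¬ G.IsGood b)
    (s : Equiv.Perm I) : (G.circuits s).card ≤ G.badCount b s := by
  simp only [IsGood, not_forall, not_not] at hG
  obtain ⟨k, k', z, z', hc⟩ := hG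
  calc (G.circuits s).card ≤ (G.crowdedWalks (extendShift s k k')).card := by
        refine Finset.card_le_card_of_injOn (fun y => merge y (merge z.1 z'.1)) ?_ ?_
        · intro y hy
          rw [Finset.mem_coe, mem_circuits] at hy
          rw [Finset.mem_coe, mem_crowdedWalks]
          refine ⟨hy.1.merge (z.2.1.merge z'.2.1), isCrowded_of_subset hc ?_⟩
          rintro _ ⟨(w | w) | (w | w), rfl⟩
          · exact ⟨.inl (.inr (.inl w)), rfl⟩
          · exact ⟨.inr (.inr (.inl w)), rfl⟩
          · exact ⟨.inl (.inr (.inr w)), rfl⟩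
          · exact ⟨.inr (.inr (.inr w)), rfl⟩
        · intro y _ y' _ h
          funext w
          rcases w with w | w
          · exact congrFun h (.inl (.inl w))
          · exact congrFun h (.inr (.inl w))
    _ ≤ ∑ k' : Fin b, (G.crowdedWalks (extendShift s k k')).card :=
        Finset.single_le_sum (f := fun k' : Fin b => (G.crowdedWalks (extendShift s k k')).card)
          (fun _ _ => Nat.zero_le _) (Finset.mem_univ k')
    _ ≤ _ := Finset.single_le_sum
          (f := fun k : Fin b => ∑ k' : Fin b, (G.crowdedWalks (extendShift s k k')).card)
          (fun _ _ => Nat.zero_le _) (Finset.mem_univ k)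

/-- With the empty index set, `badCount` dominates the indicator of not being good, which handles
bounded errors. -/
theorem card_circuits_empty (s : Equiv.Perm Empty) : 1 ≤ (G.circuits s).card :=
  Finset.card_pos.2 ⟨fun w => isEmptyElim w, mem_circuits.2 ⟨fun i => i.elim, fun i => i.elim,
    fun i => i.elim⟩⟩

namespace IsAdmissible

variable {d l : ℕ} {m : ℕ → ℕ} {M : ∀ j, Finset (Fin (m j))} {β : ℝ}

theorem tendsto_avg_badCount (h : IsAdmissible d l m M β) (b : ℕ) {I : Type*} [Finite I]
    (s : Equiv.Perm I) :
    Tendsto (fun j => avg (matchingSet d l (M j)) fun G => (G.badCount b s : ℝ)) atTop (𝓝 0) := by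
  have : Tendsto (fun j => ∑ k : Fin b, ∑ k' : Fin b, avg (matchingSet d l (M j)) fun G =>
      ((G.crowdedWalks (extendShift s k k')).card : ℝ)) atTop
      (𝓝 (∑ k : Fin b, ∑ k' : Fin b, 0)) :=
    tendsto_finsetSum _ fun k _ => tendsto_finsetSum _ fun k' _ => h.tendsto_avg_crowdedWalks _
  simp only [Finset.sum_const_zero] at this
  refine this.congr fun j => ?_
  simp only [← avg_sum]
  refine avg_congr _ fun G _ => ?_
  simp [badCount]

/-- Functions that differ only on hypergraphs that are not good, and there by at most a number of
circuits, have the same asymptotic average. -/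
theorem tendsto_avg_of_isGood (h : IsAdmissible d l m M β) (b : ℕ) {I : Type*} [Finite I]
    (s : Equiv.Perm I) {f g : ∀ j, RegHypergraph d l (m j) → ℝ} {p : ℝ}
    (hf : Tendsto (fun j => avg (matchingSet d l (M j)) (f j)) atTop (𝓝 p))
    (hgood : ∀ j G, G.IsGood b → g j G = f j G)
    (hbad : ∀ j G, ¬ G.IsGood b → |g j G - f j G| ≤ 1 + (G.circuits s).card) :
    Tendsto (fun j => avg (matchingSet d l (M j)) (g j)) atTop (𝓝 p) := by
  have hlim := (h.tendsto_avg_badCount b (Equiv.refl Empty)).add (h.tendsto_avg_badCount b s)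
  rw [add_zero] at hlim
  have : Tendsto (fun j => (avg (matchingSet d l (M j)) (g j)) -
      avg (matchingSet d l (M j)) (f j)) atTop (𝓝 0) := by
    refine squeeze_zero_norm (fun j => ?_) hlim
    rw [← avg_sub, ← avg_add, Real.norm_eq_abs]
    refine (abs_avg_le _ _).trans (avg_mono _ fun G _ => ?_)
    by_cases hG : G.IsGood b
    · rw [hgood j G hG, sub_self, abs_zero]
      positivity
    · refine (hbad j G hG).trans (add_le_add ?_ ?_)
      · exact_mod_cast (card_circuits_empty _).trans (card_circuits_le_badCount hG _)
      · exact_mod_cast card_circuits_le_badCount hG s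
  simpa using this.add hf

theorem tendsto_avg_cycleCount (h : IsAdmissible d l m M β) {b : ℕ} (k : Fin b) :
    Tendsto (fun j => avg (matchingSet d l (M j)) fun G => (G.cycleCount (k + 1) : ℝ)) atTop
      (𝓝 (cycleMeanMatching d l β (k + 1))) := by
  have hβ : β < 1 := by linarith [h.lt_half]
  have hlim := (h.tendsto_avg_card_circuits (shift (k + 1))).const_mul (1 / (2 * ((k : ℝ) + 1)))
  simp only [← avg_const_mul] at hlim
  rw [sum_prod_shift hβ, ZMod.card] at hlim
  refine h.tendsto_avg_of_isGood b (shift (k + 1)) (p := cycleMeanMatching d l β (k + 1))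
    (f := fun j G => 1 / (2 * ((k : ℝ) + 1)) * ((G.circuits (shift (k + 1))).card : ℝ)) ?_ ?_ ?_
  · convert hlim using 2
    rw [cycleMeanMatching, cycleMean]
    push_cast
    field_simp
  · intro j G hG
    rw [hG.card_circuits_shift]
    push_cast
    field_simp
  · intro j G _
    have h₁ : (G.cycleCount (k + 1) : ℝ) ≤ (G.circuits (shift (k + 1))).card := by
      exact_mod_cast cycleCount_le _
    have h₂ : 1 / (2 * ((k : ℝ) + 1)) * ((G.circuits (shift (k + 1))).card : ℝ) ≤
        (G.circuits (shift (k + 1))).card := by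
      refine mul_le_of_le_one_left (Nat.cast_nonneg _) ?_
      rw [div_le_one (by positivity)]
      have : (0 : ℝ) ≤ k := Nat.cast_nonneg _
      linarith
    have h₃ : (0 : ℝ) ≤ G.cycleCount (k + 1) := Nat.cast_nonneg _
    have h₄ : 0 ≤ 1 / (2 * ((k : ℝ) + 1)) * ((G.circuits (shift (k + 1))).card : ℝ) := by positivity
    rw [abs_le]
    constructor <;> linarith

open scoped Classical in
theorem tendsto_avg_indicator (h : IsAdmissible d l m M β) {b : ℕ} (c : Fin b → ℕ) :
    Tendsto (fun j => avg (matchingSet d l (M j)) fun G =>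
      ∏ k : Fin b, if G.cycleCount (k + 1) = c k then (1 : ℝ) else 0) atTop
      (𝓝 (∏ k : Fin b, Real.exp (-cycleMeanMatching d l β (k + 1)) *
        cycleMeanMatching d l β (k + 1) ^ c k / ((c k).factorial : ℝ))) := by
  have hβ : β < 1 := by linarith [h.lt_half]
  -- Setting the counts to `0` on bad hypergraphs keeps their factorial moments bounded there by
  -- `1`; the exact circuit formula is available only on good ones.
  let X : ∀ j, RegHypergraph d l (m j) → Fin b → ℕ := fun j G k =>
    if G.IsGood b then G.cycleCount (k + 1) else 0
  have hX := tendsto_avg_indicator_of_factorialMoments (fun j => matchingSet d l (M j)) X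
    (fun k => cycleMeanMatching d l β (k + 1)) ?_ c
  · refine h.tendsto_avg_of_isGood b (Equiv.refl Empty) hX (fun j G hG => by simp only [X, if_pos hG])
      fun j G _ => ?_
    have hle : ∀ f : Fin b → ℕ, (∏ k, if f k = c k then (1 : ℝ) else 0) ∈ Set.Icc (0 : ℝ) 1 :=
      fun f => ⟨Finset.prod_nonneg fun k _ => by split_ifs <;> norm_num,
        Finset.prod_le_one (fun k _ => by split_ifs <;> norm_num)
          fun k _ => by split_ifs <;> norm_num⟩
    have h₁ := hle fun k => G.cycleCount (k + 1)
    have h₂ := hle (X j G)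
    have h₃ : (0 : ℝ) ≤ (G.circuits (Equiv.refl Empty)).card := Nat.cast_nonneg _
    rw [abs_le]
    constructor <;> linarith [h₁.1, h₁.2, h₂.1, h₂.2]
  · intro r
    set K : ℝ := ∏ k : Fin b, (2 * ((k : ℝ) + 1)) ^ r k with hK
    have hK1 : 1 ≤ K := by
      rw [hK]
      refine Finset.prod_induction _ (fun x : ℝ => 1 ≤ x) (fun _ _ => one_le_mul_of_one_le_of_one_le)
        le_rfl fun k _ => one_le_pow₀ ?_
      have : (0 : ℝ) ≤ k := Nat.cast_nonneg _
      linarith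
    have hlim := (h.tendsto_avg_card_circuits (familyShift (familyLength r))).const_mul (1 / K)
    simp only [← avg_const_mul] at hlim
    refine h.tendsto_avg_of_isGood b (familyShift (familyLength r))
      (f := fun j G => 1 / K * ((G.circuits (familyShift (familyLength r))).card : ℝ)) ?_ ?_ ?_
    · convert hlim using 2
      have e := sum_prod_sigma (fun j : Σ k : Fin b, Fin (r k) => ZMod (familyLength r j))
        (fun j => shift (familyLength r j)) (transition β)
      unfold familyShift
      rw [e]
      simp only [familyLength, sum_prod_shift hβ]
      rw [Fintype.card_sigma, Fintype.prod_sigma, Fintype.sum_sigma, ← Finset.prod_pow_eq_pow_sum]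
      simp only [ZMod.card, Finset.prod_const, Finset.sum_const, Finset.card_univ, Fintype.card_fin,
        smul_eq_mul]
      rw [hK, ← Finset.prod_mul_distrib, one_div, ← Finset.prod_inv_distrib,
        ← Finset.prod_mul_distrib]
      refine Finset.prod_congr rfl fun k _ => ?_
      rw [cycleMeanMatching, cycleMean, mul_pow, div_pow, ← pow_mul, mul_comm (r k)]
      push_cast
      field_simp
    · intro j G hG
      simp only [X, if_pos hG]
      rw [hG.card_circuits_family r]
      push_cast
      rw [Finset.prod_mul_distrib, hK]
      field_simp
    · intro j G hG
      simp only [X, if_neg hG]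
      have h₁ : (∏ k, ((Nat.descFactorial 0 (r k) : ℕ) : ℝ)) ∈ Set.Icc (0 : ℝ) 1 := by
        have : ∀ n, ((Nat.descFactorial 0 n : ℕ) : ℝ) ≤ 1 := by
          intro n; cases n <;> simp
        exact ⟨Finset.prod_nonneg fun k _ => Nat.cast_nonneg _,
          Finset.prod_le_one (fun k _ => Nat.cast_nonneg _) fun k _ => this _⟩
      have h₂ : 1 / K * ((G.circuits (familyShift (familyLength r))).card : ℝ) ≤
          (G.circuits (familyShift (familyLength r))).card := by
        refine mul_le_of_le_one_left (Nat.cast_nonneg _) ?_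
        rw [div_le_one (by linarith)]
        exact hK1
      have h₃ : 0 ≤ 1 / K * ((G.circuits (familyShift (familyLength r))).card : ℝ) := by
        positivity
      rw [abs_le]
      constructor <;> linarith [h₁.1, h₁.2]

end IsAdmissible

end RegHypergraph

/-! ### Conditional laws as uniform averages. -/

namespace RegHypergraph

variable {d l m : ℕ}

instance : DiscreteMeasurableSpace (RegHypergraph d l m) := ⟨fun _ => trivial⟩

theorem integral_uniformOn {Ω : Type*} [Finite Ω] [MeasurableSpace Ω] [DiscreteMeasurableSpace Ω]
    (S : Finset Ω) (f : Ω → ℝ) : ∫ ω, f ω ∂(uniformOn (S : Set Ω)) = avg S f := by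
  classical
  have := Fintype.ofFinite Ω
  rcases S.eq_empty_or_nonempty with rfl | hS
  · simp [avg]
  have hP := isProbabilityMeasure_uniformOn S.finite_toSet (Finset.coe_nonempty.2 hS)
  rw [integral_fintype (Integrable.of_finite), avg, Finset.sum_div,
    ← Finset.sum_subset (Finset.subset_univ S)]
  · refine Finset.sum_congr rfl fun ω hω => ?_
    rw [measureReal_def, ← Finset.coe_singleton, uniformOn_apply_finset,
      Finset.inter_singleton_of_mem hω]
    simp [div_eq_inv_mul]
  · intro ω _ hω
    rw [measureReal_def, ← Finset.coe_singleton, uniformOn_apply_finset,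
      Finset.inter_singleton_of_notMem hω]
    simp

theorem cond_randomRegHypergraph (M : Finset (Fin m)) :
    (randomRegHypergraph d l m)[|{G | G.IsMatching M}] =
      uniformOn (matchingSet d l M : Set (RegHypergraph d l m)) := by
  have : (matchingSet d l M : Set (RegHypergraph d l m)) = {G | G.IsMatching M} := by
    simp [matchingSet]
  rw [this, randomRegHypergraph, uniformOn, uniformOn,
    cond_cond_eq_cond_inter MeasurableSet.univ .of_discrete, Set.univ_inter]

theorem randomRegHypergraph_eq :
    randomRegHypergraph d l m =
      uniformOn (matchingSet d l (∅ : Finset (Fin m)) : Set (RegHypergraph d l m)) := by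
  have : (matchingSet d l (∅ : Finset (Fin m)) : Set (RegHypergraph d l m)) = Set.univ := by
    ext G
    simp [matchingSet, isMatching_iff]
  rw [this, randomRegHypergraph]

theorem IsAdmissible.cycleCountsTendToPoisson {d l : ℕ} {m : ℕ → ℕ} {M : ∀ j, Finset (Fin (m j))} {β : ℝ}
    (h : IsAdmissible d l m M β) (b : ℕ) :
    CycleCountsTendToPoisson (fun j => uniformOn (matchingSet d l (M j) : Set (RegHypergraph d l (m j)))) b
      (cycleMeanMatching d l β) := by
  classical
  constructor
  · intro c
    refine (h.tendsto_avg_indicator c).congr fun j => ?_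
    rw [← integral_indicator_one (.of_discrete), integral_uniformOn]
    refine avg_congr _ fun G _ => ?_
    rw [Finset.prod_ite_zero]
    simp [Set.indicator_apply]
  · intro k
    simp only [integral_uniformOn]
    exact_mod_cast h.tendsto_avg_cycleCount k

end RegHypergraph

theorem lemmal33 (d l : ℕ) (hd : 2 ≤ d) (hl : 2 ≤ l) (b : ℕ)
    (m : ℕ → ℕ) (hm : Tendsto m atTop atTop) (hdvd : ∀ j, d ∣ l * m j) :
    CycleCountsTendToPoisson (fun j => randomRegHypergraph d l (m j)) b (cycleMean d l) ∧
    ∀ (β : ℝ), 0 < β → β < 1 / (d : ℝ) →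
      ∀ (M₀ : ∀ j, Finset (Fin (m j))),
        Tendsto (fun j => ((M₀ j).card : ℝ) / (m j : ℝ)) atTop (𝓝 β) →
        CycleCountsTendToPoisson
          (fun j => (randomRegHypergraph d l (m j))[|{G | G.IsMatching (M₀ j)}])
          b (cycleMeanMatching d l β) := by
  constructor
  · have h : RegHypergraph.IsAdmissible d l m (fun _ => ∅) 0 :=
      ⟨hd, hl, hm, hdvd, le_rfl, by positivity, by simp, fun _ _ => rfl⟩
    -- The positive exponent matters: `0 ^ 0 = 1` would double the mean.
    have hmean : ∀ k : ℕ, cycleMeanMatching d l 0 (k + 1) = cycleMean d l (k + 1) := by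
      intro k
      simp [cycleMeanMatching]
    have := h.cycleCountsTendToPoisson b
    simp only [CycleCountsTendToPoisson, ← RegHypergraph.randomRegHypergraph_eq, hmean] at this
    exact this
  · intro β h₀ h₁ M₀ hM
    have h : RegHypergraph.IsAdmissible d l m M₀ β :=
      ⟨hd, hl, hm, hdvd, h₀.le, h₁, hM, fun h => absurd h h₀.ne'⟩
    simp only [RegHypergraph.cond_randomRegHypergraph]
    exact h.cycleCountsTendToPoisson b
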